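/- Let $\Gamma$ be a finitely generated group and let $\mu\colon\Gamma\times\Gamma\to[0,\infty)$ be a $\Gamma$-invariant, finitely supported, symmetric and irreducible random walk on $\Gamma$. That is, $\mu(\gamma\gamma',\gamma\gamma'')=\mu(\gamma',\gamma'')$ and $\mu(\gamma,\gamma')=\mu(\gamma',\gamma)$; for each $\gamma$, $\mu(\gamma,\gamma')=0$ for all but finitely many $\gamma'$, and $\sum_{\gamma'}\mu(\gamma,\gamma')=1$; and any $\gamma,\gamma'\in\Gamma$ are joined by a finite sequence $\gamma=\gamma_0,\dots,\gamma_k=\gamma'$ with $\mu(\gamma_i,\gamma_{i+1})\neq0$ for all $i<k$. Let $\mu^n$ denote the $n$-th convolution of $\mu$, i.e. the $n$-step transition probability. Let $Y$ be a complete metric space which is either a finite-dimensional smooth Riemannian manifold whose distance makes it a $\mathrm{CAT}(0)$ space, or an $\mathbb{R}$-tree (any two points are joined by a geodesic segment, which is the only arc joining them). Let $\rho\colon\Gamma\to\mathrm{Isom}(Y)$ be a homomorphism such that $\rho(\Gamma)$ has a global fixed point. A map $f\colon\Gamma\to Y$ is called $\rho$-equivariant if $f(\gamma\gamma')=\rho(\gamma)f(\gamma')$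 for all $\gamma,\gamma'\in\Gamma$, and its energies are $$E_{\mu^n}(f)=\frac12\sum_{\gamma\in\Gamma}\mu^n(e,\gamma)\,d_Y(f(e),f(\gamma))^2,\qquad E_\mu(f)=E_{\mu^1}(f).$$ Then there is a constant $C_\rho>0$ such that $E_{\mu^n}(f)\le C_\rho E_\mu(f)$ for every $n\in\mathbb{N}$ and every $\rho$-equivariant map $f$. In particular, for every integer $n>C_\rho$ there is $\varepsilon>0$ such that $E_{\mu^n}(f)\le(n-\varepsilon)E_\mu(f)$ for every $\rho$-equivariant map $f$; so there exist a positive integer $n$ and $\varepsilon>0$ as required in Gromov's fixed-point criterion. If $Y$ is an $\mathbb{R}$-tree, one may take $C_\rho=\bigl(\min\{\mu(e,s)\mid s\in\Gamma,\ \mu(e,s)\neq0\}\bigr)^{-1}$. -/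

import Mathlib

open scoped Manifold ContDiff Bundle

noncomputable section

namespace NStepEnergy

section MetricGeometry

variable {Y : Type*} [MetricSpace Y]

/-- The restriction of `c` to `[0,1]` is a (constant speed) geodesic joining `p` to `q`.
Values of `c` outside `[0,1]` are irrelevant. -/
structure IsGeodesic (c : ℝ → Y) (p q : Y) : Prop where
  map_zero : c 0 = p
  map_one : c 1 = q
  dist_eq : ∀ s ∈ Set.Icc (0 : ℝ) 1, ∀ t ∈ Set.Icc (0 : ℝ) 1,
    dist (c s) (c t) = |s - t| * dist p q

variable (Y)

/-- Any two points are joined by a geodesic. -/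
def IsGeodesicSpace : Prop :=
  ∀ p q : Y, ∃ c : ℝ → Y, IsGeodesic c p q

/-- A CAT(0) space: a geodesic space in which every geodesic triangle, with vertices `p i` and
sides `c i` joining `p i` to `p (i + 1)` (indices modulo 3), is at least as thin as its comparison
triangle, with vertices `p' i`, in the Euclidean plane. The comparison point of `c i s` is the
point at parameter `s` on the segment from `p' i` to `p' (i + 1)`. -/
def IsCAT0 : Prop :=
  IsGeodesicSpace Y ∧
    ∀ (p : Fin 3 → Y) (c : Fin 3 → ℝ → Y), (∀ i, IsGeodesic (c i) (p i) (p (i + 1))) →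
    ∀ p' : Fin 3 → EuclideanSpace ℝ (Fin 2),
      (∀ i, dist (p' i) (p' (i + 1)) = dist (p i) (p (i + 1))) →
    ∀ i j : Fin 3, ∀ s ∈ Set.Icc (0 : ℝ) 1, ∀ t ∈ Set.Icc (0 : ℝ) 1,
      dist (c i s) (c j t) ≤
        dist (AffineMap.lineMap (p' i) (p' (i + 1)) s : EuclideanSpace ℝ (Fin 2))
          (AffineMap.lineMap (p' j) (p' (j + 1)) t)

/-- An `ℝ`-tree: any two points are joined by a geodesic segment, and this segment is the only
arc (injective continuous path) joining them. -/
def IsRTree : Prop :=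
  ∀ x y : Y, ∃ c : ℝ → Y, IsGeodesic c x y ∧
    ∀ γ : Path x y, Function.Injective γ → Set.range γ = c '' Set.Icc (0 : ℝ) 1

/-- The metric of `Y` is the distance function of a smooth Riemannian metric for some structure
of a finite-dimensional smooth manifold (without boundary) on the topological space `Y`. -/
def IsRiemannianManifoldMetric : Prop :=
  ∃ (d : ℕ) (_ : ChartedSpace (EuclideanSpace ℝ (Fin d)) Y) (_ : IsManifold (𝓡 d) ∞ Y)
    (_ : Bundle.RiemannianBundle (fun x : Y => TangentSpace (𝓡 d) x)),
    IsContMDiffRiemannianBundle (𝓡 d) ∞ (EuclideanSpace ℝ (Fin d))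
      (fun x : Y => TangentSpace (𝓡 d) x) ∧
    IsRiemannianManifold (𝓡 d) Y

end MetricGeometry

section RandomWalk

variable {Γ : Type*} [Group Γ]

/-- `μ` is the transition function of a `Γ`-invariant, finitely supported, symmetric and
irreducible random walk on `Γ`. -/
structure IsRandomWalk (μ : Γ → Γ → ℝ) : Prop where
  nonneg : ∀ γ γ', 0 ≤ μ γ γ'
  invariant : ∀ γ γ' γ'', μ (γ * γ') (γ * γ'') = μ γ' γ''
  finite_support : ∀ γ, (Function.support (μ γ)).Finite
  sum_eq_one : ∀ γ, ∑ᶠ γ', μ γ γ' = 1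
  symm : ∀ γ γ', μ γ γ' = μ γ' γ
  irreducible : ∀ γ γ', ∃ (n : ℕ) (g : ℕ → Γ), g 0 = γ ∧ g n = γ' ∧
    ∀ i < n, μ (g i) (g (i + 1)) ≠ 0

open Classical in
/-- The `n`-th convolution `μⁿ`: the `n`-step transition function. -/
def convPow (μ : Γ → Γ → ℝ) : ℕ → Γ → Γ → ℝ
  | 0 => fun γ γ' => if γ = γ' then 1 else 0
  | n + 1 => fun γ γ' => ∑ᶠ γ₁, μ γ γ₁ * convPow μ n γ₁ γ'

variable {Y : Type*} [MetricSpace Y]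

/-- `f` is `ρ`-equivariant. -/
def IsEquivariant (ρ : Γ →* (Y ≃ᵢ Y)) (f : Γ → Y) : Prop :=
  ∀ γ γ', f (γ * γ') = ρ γ (f γ')

/-- The energy of `f` with respect to the transition function `μ`, with base point the identity
of `Γ`. -/
def energy (μ : Γ → Γ → ℝ) (f : Γ → Y) : ℝ :=
  1 / 2 * ∑ᶠ γ, μ 1 γ * dist (f 1) (f γ) ^ 2

/-- The `n`-step energies of all `ρ`-equivariant maps are at most `C` times their energies. -/
def EnergyBound (μ : Γ → Γ → ℝ) (ρ : Γ →* (Y ≃ᵢ Y)) (C : ℝ) : Prop :=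
  ∀ (n : ℕ) (f : Γ → Y), IsEquivariant ρ f → energy (convPow μ n) f ≤ C * energy μ f

/-- The hypothesis of Gromov's fixed-point criterion, for the step number `n`. -/
def GromovCriterion (μ : Γ → Γ → ℝ) (ρ : Γ →* (Y ≃ᵢ Y)) (n : ℕ) : Prop :=
  0 < n ∧ ∃ ε : ℝ, 0 < ε ∧ ∀ f : Γ → Y, IsEquivariant ρ f →
    energy (convPow μ n) f ≤ (n - ε) * energy μ f

end RandomWalk

end NStepEnergy

end

namespace NStepEnergy

open Filter Topology

/-! By equivariance a map `f` is determined by `y = f 1`, and `f γ = ρ γ y`. Each `convPow μ n` is a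
probability, so every n-step energy is at most half the square of any bound for the displacements
`dist y (ρ γ y)`. It therefore suffices to bound all displacements of `y` by those under single
steps, with a constant independent of `y` (`IsRandomWalk.energyBound_of_displacement`).

In an ℝ-tree, consider the geodesic from a global fixed point to `y`. An isometry fixing its start
fixes an initial piece of it and moves `y` by twice the length of the rest
(`IsRTree.exists_fixed_initial`). The shortest of the pieces fixed by the steps ends at a point
fixed by all steps, hence by the group, so no element moves `y` further than the corresponding step
does. One summand of the energy then gives the explicit constant.

In a CAT(0) manifold, let `q` be the fixed point nearest to `y`; displacements of `y` are at most `2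
* dist q y`. Let `w` be the initial direction of the geodesic from `q` to `y`, of length `dist q y`.
Geodesic contraction shows that the tangent representation at `q` displaces `w` at most as much as
`ρ` displaces `y`, and `w` is orthogonal to the invariant vectors, since otherwise some fixed point
would be closer to `y` (`IsCAT0.exists_tangent_vector`). The averaging operator of the walk is
symmetric, and its eigenvectors for the eigenvalue 1 are invariant, so a spectral gap κ bounds `κ *
‖w‖ ^ 2` by the one-step displacement energy of `w`. The gap can be chosen independently of `q`: the
fixed set is connected, and the tangent representations at nearby fixed points are uniformly close,
hence linearly equivalent (`exists_intertwiner`), so the eigenvalues never change.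

The tangent representations come from the distance alone. Affine changes of a single chart make the
distance Euclidean up to a relative error O(r) on balls of radius r, and an isometry read in such
charts has an isometric derivative at the centre, with a remainder of order 3/2 that is uniform over
the group (`exists_linearIsometry_approx`). -/

/-- A nonnegative function on a complete space that is uniformly convex with respect to some
choice of midpoints has a unique minimizer on a closed set. -/
theorem exists_unique_minimizer {X : Type*} [MetricSpace X] [CompleteSpace X] {F : Set X}
    (hne : F.Nonempty) {g : X → ℝ} (hg : ∀ x ∈ F, 0 ≤ g x) {κ : ℝ} (hκ : 0 < κ)
    (hmid : ∀ a ∈ F, ∀ b ∈ F, ∃ m ∈ F, g m ≤ (g a + g b) / 2 - κ * dist a b ^ 2)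
    (hclosed : ∀ c : ℝ, IsClosed {x | x ∈ F ∧ g x ≤ c}) :
    ∃ x ∈ F, (∀ y ∈ F, g x ≤ g y) ∧ ∀ y ∈ F, g y ≤ g x → y = x := by
  set I := sInf (g '' F) with hI
  have hbdd : BddBelow (g '' F) := ⟨0, by rintro _ ⟨x, hx, rfl⟩; exact hg x hx⟩
  have hle : ∀ x ∈ F, I ≤ g x := fun x hx => csInf_le hbdd ⟨x, hx, rfl⟩
  -- Almost-minimizers are close together, because the value at their midpoint cannot drop below the
  -- infimum. This makes minimizing sequences Cauchy, and `η = 0` gives uniqueness.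
  have hclose : ∀ a ∈ F, ∀ b ∈ F, ∀ η : ℝ, g a ≤ I + η → g b ≤ I + η →
      κ * dist a b ^ 2 ≤ η := by
    intro a ha b hb η h1 h2
    obtain ⟨m, hm, hgm⟩ := hmid a ha b hb
    have := hle m hm
    linarith
  have hex : ∀ n : ℕ, ∃ x ∈ F, g x ≤ I + 1 / ((n : ℝ) + 1) := by
    intro n
    have hpos : (0 : ℝ) < 1 / ((n : ℝ) + 1) := by positivity
    obtain ⟨_, ⟨x, hx, rfl⟩, hlt⟩ := exists_lt_of_csInf_lt (hne.image g)
      (show sInf (g '' F) < I + 1 / ((n : ℝ) + 1) by linarith)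
    exact ⟨x, hx, hlt.le⟩
  choose u huF hu using hex
  have hanti : ∀ m n : ℕ, m ≤ n → 1 / ((n : ℝ) + 1) ≤ 1 / ((m : ℝ) + 1) := fun m n h =>
    one_div_le_one_div_of_le (by positivity) (by exact_mod_cast Nat.succ_le_succ h)
  have hcauchy : CauchySeq u := by
    rw [Metric.cauchySeq_iff']
    intro ε hε
    obtain ⟨N, hN⟩ := exists_nat_one_div_lt (show 0 < κ * ε ^ 2 by positivity)
    refine ⟨N, fun n hn => ?_⟩
    have h1 := hclose (u n) (huF n) (u N) (huF N) (1 / ((N : ℝ) + 1))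
      ((hu n).trans (by linarith [hanti N n hn])) (hu N)
    have h2 : dist (u n) (u N) ^ 2 < ε ^ 2 := by
      by_contra hcon
      push Not at hcon
      have := mul_le_mul_of_nonneg_left hcon hκ.le
      linarith
    exact lt_of_pow_lt_pow_left₀ 2 hε.le h2
  obtain ⟨x, hx⟩ := cauchySeq_tendsto_of_complete hcauchy
  have hsub : ∀ N : ℕ, x ∈ F ∧ g x ≤ I + 1 / ((N : ℝ) + 1) := by
    intro N
    refine (hclosed (I + 1 / ((N : ℝ) + 1))).mem_of_tendsto hx ?_
    filter_upwards [eventually_ge_atTop N] with n hn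
    exact ⟨huF n, (hu n).trans (by linarith [hanti N n hn])⟩
  have hgx : g x ≤ I := by
    refine le_of_forall_pos_lt_add fun ε hε => ?_
    obtain ⟨N, hN⟩ := exists_nat_one_div_lt hε
    linarith [(hsub N).2]
  refine ⟨x, (hsub 0).1, fun y hy => hgx.trans (hle y hy), fun y hy hyx => ?_⟩
  have h := hclose y hy x (hsub 0).1 0 (by linarith) (by linarith)
  have h0 : dist y x ^ 2 ≤ 0 := by
    by_contra hcon
    push Not at hcon
    have := mul_pos hκ hcon
    linarith
  exact dist_eq_zero.1 (pow_eq_zero_iff (two_ne_zero) |>.1 (le_antisymm h0 (sq_nonneg _)))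

/-! ### Geodesics and comparison in CAT(0) spaces -/

section Geodesics

variable {Y : Type*} [MetricSpace Y]

theorem IsGeodesic.reverse {c : ℝ → Y} {p q : Y} (h : IsGeodesic c p q) :
    IsGeodesic (fun t => c (1 - t)) q p where
  map_zero := by simpa using h.map_one
  map_one := by simpa using h.map_zero
  dist_eq s hs t ht := by
    rw [h.dist_eq _ ⟨by linarith [hs.2], by linarith [hs.1]⟩ _
      ⟨by linarith [ht.2], by linarith [ht.1]⟩, dist_comm q p, abs_sub_comm s t]
    ring_nf

theorem IsGeodesic.comp_isometry {c : ℝ → Y} {p q : Y} (h : IsGeodesic c p q) (g : Y ≃ᵢ Y) :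
    IsGeodesic (fun t => g (c t)) (g p) (g q) where
  map_zero := by rw [h.map_zero]
  map_one := by rw [h.map_one]
  dist_eq s hs t ht := by rw [g.dist_eq, g.dist_eq, h.dist_eq s hs t ht]

theorem IsGeodesic.dist_left {c : ℝ → Y} {p q : Y} (h : IsGeodesic c p q) {t : ℝ}
    (ht : t ∈ Set.Icc (0 : ℝ) 1) : dist p (c t) = t * dist p q := by
  have := h.dist_eq 0 (by simp) t ht
  rwa [h.map_zero, zero_sub, abs_neg, abs_of_nonneg ht.1] at this

theorem IsGeodesic.dist_right {c : ℝ → Y} {p q : Y} (h : IsGeodesic c p q) {t : ℝ}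
    (ht : t ∈ Set.Icc (0 : ℝ) 1) : dist (c t) q = (1 - t) * dist p q := by
  have := h.dist_eq t ht 1 (by simp)
  rwa [h.map_one, abs_sub_comm, abs_of_nonneg (by linarith [ht.2])] at this

theorem IsGeodesic.continuousOn {c : ℝ → Y} {p q : Y} (h : IsGeodesic c p q) :
    ContinuousOn c (Set.Icc 0 1) := by
  refine LipschitzOnWith.continuousOn (K := ⟨dist p q, dist_nonneg⟩) ?_
  refine LipschitzOnWith.of_dist_le_mul fun s hs t ht => ?_
  rw [h.dist_eq s hs t ht, Real.dist_eq, mul_comm]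
  rfl

/-- Three nonnegative numbers satisfying the triangle inequalities are the side lengths of a
Euclidean triangle. -/
theorem exists_comparison_triangle (p : Fin 3 → Y) :
    ∃ p' : Fin 3 → EuclideanSpace ℝ (Fin 2),
      ∀ i, dist (p' i) (p' (i + 1)) = dist (p i) (p (i + 1)) := by
  set a := dist (p 0) (p 1) with ha
  set b := dist (p 2) (p 0) with hb
  set c := dist (p 1) (p 2) with hc
  have ha0 : 0 ≤ a := dist_nonneg
  have hb0 : 0 ≤ b := dist_nonneg
  have hc0 : 0 ≤ c := dist_nonneg
  have h1 : a ≤ b + c := by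
    have := dist_triangle (p 0) (p 2) (p 1)
    rw [dist_comm (p 0) (p 2), dist_comm (p 2) (p 1)] at this
    exact this
  have h2 : b ≤ c + a := by
    have := dist_triangle (p 2) (p 1) (p 0)
    rw [dist_comm (p 2) (p 1), dist_comm (p 1) (p 0)] at this
    exact this
  have h3 : c ≤ a + b := by
    have := dist_triangle (p 1) (p 0) (p 2)
    rw [dist_comm (p 1) (p 0), dist_comm (p 0) (p 2)] at this
    exact this
  -- The vertices are placed at (0, 0), (a, 0) and (x, y); the law of cosines gives x, unless a = 0.
  obtain ⟨x, y, hxy, hxy'⟩ : ∃ x y : ℝ, x ^ 2 + y ^ 2 = b ^ 2 ∧ (a - x) ^ 2 + y ^ 2 = c ^ 2 := by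
    rcases ha0.eq_or_lt with h | h
    · refine ⟨b, 0, by ring, ?_⟩
      have : b = c := by linarith
      rw [← h, this]; ring
    · have hx : 0 ≤ b ^ 2 - ((a ^ 2 + b ^ 2 - c ^ 2) / (2 * a)) ^ 2 := by
        rw [div_pow, sub_nonneg, div_le_iff₀ (by positivity)]
        -- Heron's factorization: 4a²b² - (a² + b² - c²)² is the product of c² - (a - b)² and (a +
        -- b)² - c².
        have k1 : 0 ≤ (c - (a - b)) * (c + (a - b)) :=
          mul_nonneg (by linarith) (by linarith)
        have k2 : 0 ≤ (a + b - c) * (a + b + c) := mul_nonneg (by linarith) (by linarith)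
        nlinarith [mul_nonneg k1 k2]
      refine ⟨(a ^ 2 + b ^ 2 - c ^ 2) / (2 * a),
        √(b ^ 2 - ((a ^ 2 + b ^ 2 - c ^ 2) / (2 * a)) ^ 2), ?_, ?_⟩
      · rw [Real.sq_sqrt hx]; ring
      · rw [Real.sq_sqrt hx]; field_simp; ring
  refine ⟨![!₂[0, 0], !₂[a, 0], !₂[x, y]], fun i => ?_⟩
  fin_cases i
  · simp [EuclideanSpace.dist_eq, Fin.sum_univ_two, Real.dist_eq, Real.sqrt_sq_eq_abs]
    exact abs_of_nonneg ha0
  · simp [EuclideanSpace.dist_eq, Fin.sum_univ_two, Real.dist_eq]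
    rw [hxy', Real.sqrt_sq hc0]
  · simp [EuclideanSpace.dist_eq, Fin.sum_univ_two, Real.dist_eq]
    rw [hxy, Real.sqrt_sq hb0]

/-- In a `CAT(0)` space the geodesic contraction towards a point contracts distances. -/
theorem IsCAT0.dist_le_mul (hY : IsCAT0 Y) {q y y' : Y} {c c' : ℝ → Y} (hc : IsGeodesic c q y)
    (hc' : IsGeodesic c' q y') {t : ℝ} (ht : t ∈ Set.Icc (0 : ℝ) 1) :
    dist (c t) (c' t) ≤ t * dist y y' := by
  obtain ⟨d, hd⟩ := hY.1 y y'
  obtain ⟨p', hp'⟩ := exists_comparison_triangle ![q, y, y']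
  -- The third side runs from `y'` back to `q`, so `c'` is reversed and its point at `t` has
  -- parameter `1 - t`.
  have h := hY.2 ![q, y, y'] ![c, d, fun t => c' (1 - t)] (by
    intro i
    fin_cases i
    · exact hc
    · exact hd
    · exact hc'.reverse) p' hp' 0 2 t ht (1 - t) ⟨by linarith [ht.2], by linarith [ht.1]⟩
  have h1 : dist (p' 1) (p' 2) = dist y y' := hp' 1
  have h2 : (2 : Fin 3) + 1 = 0 := rfl
  have h3 : (0 : Fin 3) + 1 = 1 := rfl
  simp only [Matrix.cons_val, sub_sub_cancel, h2, h3] at h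
  refine h.trans (le_of_eq ?_)
  rw [AffineMap.lineMap_apply_one_sub, ← h1, dist_eq_norm, dist_eq_norm,
    AffineMap.lineMap_apply_module, AffineMap.lineMap_apply_module]
  rw [show (1 - t) • p' 0 + t • p' 1 - ((1 - t) • p' 0 + t • p' 2) = t • (p' 1 - p' 2) by module,
    norm_smul, Real.norm_of_nonneg ht.1]

/-- The Bruhat-Tits inequality. -/
theorem IsCAT0.dist_midpoint_sq_le (hY : IsCAT0 Y) {a b : Y} {c : ℝ → Y} (hc : IsGeodesic c a b)
    (x : Y) :
    dist (c (1 / 2)) x ^ 2 ≤ (dist a x ^ 2 + dist b x ^ 2) / 2 - 1 / 4 * dist a b ^ 2 := by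
  obtain ⟨d, hd⟩ := hY.1 b x
  obtain ⟨d', hd'⟩ := hY.1 x a
  obtain ⟨p', hp'⟩ := exists_comparison_triangle ![a, b, x]
  have h := hY.2 ![a, b, x] ![c, d, d'] (by
    intro i
    fin_cases i
    · exact hc
    · exact hd
    · exact hd') p' hp' 0 2 (1 / 2) (by norm_num) 0 (by simp)
  have h1 : dist (p' 0) (p' 1) = dist a b := hp' 0
  have h2 : dist (p' 1) (p' 2) = dist b x := hp' 1
  have h3 : dist (p' 2) (p' 0) = dist x a := hp' 2
  have h4 : (2 : Fin 3) + 1 = 0 := rfl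
  have h5 : (0 : Fin 3) + 1 = 1 := rfl
  simp only [Matrix.cons_val, h4, h5, AffineMap.lineMap_apply_zero, hd'.map_zero] at h
  have h6 : dist (c (1 / 2)) x ^ 2 ≤
      dist (AffineMap.lineMap (p' 0) (p' 1) (1 / 2 : ℝ) : EuclideanSpace ℝ (Fin 2)) (p' 2) ^ 2 :=
    pow_le_pow_left₀ dist_nonneg h 2
  refine h6.trans (le_of_eq ?_)
  rw [dist_comm a x, ← h1, ← h2, ← h3, dist_comm (p' 2) (p' 0), dist_eq_norm, dist_eq_norm,
    dist_eq_norm, dist_eq_norm, AffineMap.lineMap_apply_module]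
  have h7 := parallelogram_law_with_norm ℝ ((1 / 2 : ℝ) • (p' 0 - p' 2))
    ((1 / 2 : ℝ) • (p' 1 - p' 2))
  rw [show (1 / 2 : ℝ) • (p' 0 - p' 2) + (1 / 2 : ℝ) • (p' 1 - p' 2)
      = (1 - 1 / 2 : ℝ) • p' 0 + (1 / 2 : ℝ) • p' 1 - p' 2 by module,
    show (1 / 2 : ℝ) • (p' 0 - p' 2) - (1 / 2 : ℝ) • (p' 1 - p' 2)
      = (1 / 2 : ℝ) • (p' 0 - p' 1) by module, norm_smul, norm_smul, norm_smul] at h7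
  norm_num at h7 ⊢
  linarith

end Geodesics

/-! ### Fixed sets of isometric actions on CAT(0) spaces -/

section FixedPoints

variable {Γ : Type*} [Group Γ] {Y : Type*} [MetricSpace Y]

/-- The common fixed points of an action by isometries. -/
def fixedSet (ρ : Γ →* (Y ≃ᵢ Y)) : Set Y := {p | ∀ γ, ρ γ p = p}

theorem isClosed_fixedSet (ρ : Γ →* (Y ≃ᵢ Y)) : IsClosed (fixedSet ρ) := by
  simp only [fixedSet, Set.ofPred_forall]
  exact isClosed_iInter fun γ => isClosed_eq (ρ γ).continuous continuous_id

/-- An isometry fixing both ends carries the geodesic to one with the same ends, and the contraction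
inequality with equal endpoints makes geodesics unique. -/
theorem IsCAT0.geodesic_mem_fixedSet (hY : IsCAT0 Y) {ρ : Γ →* (Y ≃ᵢ Y)} {a b : Y}
    (ha : a ∈ fixedSet ρ) (hb : b ∈ fixedSet ρ) {c : ℝ → Y} (hc : IsGeodesic c a b) {t : ℝ}
    (ht : t ∈ Set.Icc (0 : ℝ) 1) : c t ∈ fixedSet ρ := by
  intro γ
  have h1 := hc.comp_isometry (ρ γ)
  rw [ha γ, hb γ] at h1
  have h2 := hY.dist_le_mul h1 hc ht
  rw [dist_self, mul_zero] at h2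
  exact dist_le_zero.1 h2

/-- Connectedness is what carries the type of the tangent representation from one fixed point to all
others. -/
theorem IsCAT0.isPreconnected_fixedSet (hY : IsCAT0 Y) (ρ : Γ →* (Y ≃ᵢ Y)) :
    IsPreconnected (fixedSet ρ) := by
  refine isPreconnected_of_forall_pair fun a ha b hb => ?_
  obtain ⟨c, hc⟩ := hY.1 a b
  refine ⟨c '' Set.Icc 0 1, ?_, ⟨0, by simp, hc.map_zero⟩, ⟨1, by simp, hc.map_one⟩,
    isPreconnected_Icc.image c hc.continuousOn⟩
  rintro _ ⟨t, ht, rfl⟩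
  exact hY.geodesic_mem_fixedSet ha hb hc ht

/-- Every point has a nearest common fixed point. -/
theorem IsCAT0.exists_nearest_fixed [CompleteSpace Y] (hY : IsCAT0 Y) (ρ : Γ →* (Y ≃ᵢ Y))
    (hne : (fixedSet ρ).Nonempty) (y : Y) :
    ∃ q ∈ fixedSet ρ, ∀ z ∈ fixedSet ρ, dist q y ≤ dist z y := by
  obtain ⟨q, hq, hmin, -⟩ := exists_unique_minimizer hne (g := fun x => dist x y ^ 2)
    (fun _ _ => by positivity) (κ := 1 / 4) (by norm_num) (fun a ha b hb => by
      obtain ⟨c, hc⟩ := hY.1 a b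
      exact ⟨c (1 / 2), hY.geodesic_mem_fixedSet ha hb hc (by norm_num),
        hY.dist_midpoint_sq_le hc y⟩)
    (fun c => (isClosed_fixedSet ρ).inter
      (isClosed_le ((continuous_id.dist continuous_const).pow 2) continuous_const))
  exact ⟨q, hq, fun z hz => le_of_pow_le_pow_left₀ two_ne_zero dist_nonneg (hmin z hz)⟩

/-- A point that is moved at most `r` lies within distance `r` of a common fixed point. -/
theorem IsCAT0.exists_fixed_dist_le [CompleteSpace Y] (hY : IsCAT0 Y) (ρ : Γ →* (Y ≃ᵢ Y))
    {x : Y} {r : ℝ} (hx : ∀ γ, dist (ρ γ x) x ≤ r) :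
    ∃ z ∈ fixedSet ρ, dist z x ≤ r := by
  have hr : 0 ≤ r := dist_nonneg.trans (hx 1)
  -- The fixed point is the circumcentre of the orbit of `x`: the supremum inherits uniform
  -- convexity from the Bruhat-Tits inequality, and invariance of the orbit makes its unique
  -- minimizer fixed.
  set g : Y → ℝ := fun y => ⨆ γ, dist y (ρ γ x) ^ 2 with hg
  have hbdd : ∀ y, BddAbove (Set.range fun γ => dist y (ρ γ x) ^ 2) := by
    intro y
    refine ⟨(dist y x + r) ^ 2, ?_⟩
    rintro _ ⟨γ, rfl⟩
    refine pow_le_pow_left₀ dist_nonneg ((dist_triangle y x _).trans ?_) 2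
    rw [dist_comm x]
    linarith [hx γ]
  have hle : ∀ y γ, dist y (ρ γ x) ^ 2 ≤ g y := fun y γ => le_ciSup (hbdd y) γ
  obtain ⟨z, -, hmin, huniq⟩ := exists_unique_minimizer (F := Set.univ) ⟨x, trivial⟩ (g := g)
    (fun y _ => (sq_nonneg _).trans (hle y 1)) (κ := 1 / 4) (by norm_num) (fun a _ b _ => by
      obtain ⟨c, hc⟩ := hY.1 a b
      refine ⟨c (1 / 2), trivial, ciSup_le fun γ => ?_⟩
      have := hY.dist_midpoint_sq_le hc (ρ γ x)
      linarith [hle a γ, hle b γ])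
    (fun c => by
      have : {y | y ∈ Set.univ ∧ g y ≤ c} = ⋂ γ, {y | dist y (ρ γ x) ^ 2 ≤ c} := by
        ext y
        simp only [Set.mem_univ, true_and, Set.mem_ofPred_eq, Set.mem_iInter]
        exact ⟨fun h γ => (hle y γ).trans h, fun h => ciSup_le h⟩
      rw [this]
      exact isClosed_iInter fun γ =>
        isClosed_le ((continuous_id.dist continuous_const).pow 2) continuous_const)
  refine ⟨z, fun γ => huniq _ trivial (ciSup_le fun γ' => ?_), ?_⟩
  · have h := hle z (γ⁻¹ * γ')
    rw [← (ρ γ).dist_eq, ← IsometryEquiv.mul_apply, ← map_mul, mul_inv_cancel_left] at h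
    exact h
  · have h1 : g x ≤ r ^ 2 := ciSup_le fun γ => by
      rw [dist_comm]
      exact pow_le_pow_left₀ dist_nonneg (hx γ) 2
    have h2 := (hle z 1).trans ((hmin x trivial).trans h1)
    rw [map_one] at h2
    change dist z x ^ 2 ≤ r ^ 2 at h2
    exact le_of_pow_le_pow_left₀ two_ne_zero hr h2

end FixedPoints

/-! ### Convolution powers, energies and steps of the random walk -/

section RandomWalk

variable {Γ : Type*} [Group Γ] {μ : Γ → Γ → ℝ}

theorem IsRandomWalk.convPow_nonneg (hμ : IsRandomWalk μ) (n : ℕ) (γ γ' : Γ) :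
    0 ≤ convPow μ n γ γ' := by
  induction n generalizing γ with
  | zero => simp only [convPow]; split_ifs <;> norm_num
  | succ n ih => exact finsum_nonneg fun γ₁ => mul_nonneg (hμ.nonneg _ _) (ih γ₁)

theorem IsRandomWalk.convPow_succ_eq_sum (hμ : IsRandomWalk μ) (n : ℕ) (γ γ' : Γ) :
    convPow μ (n + 1) γ γ' =
      ∑ γ₁ ∈ (hμ.finite_support γ).toFinset, μ γ γ₁ * convPow μ n γ₁ γ' := by
  refine finsum_eq_sum_of_support_subset _ fun γ₁ h => ?_
  simp only [Function.mem_support, Set.Finite.coe_toFinset] at h ⊢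
  exact left_ne_zero_of_mul h

/-- A `finsum` over an infinite support is 0 by default, so finiteness is carried through the
induction together with the total mass. -/
theorem IsRandomWalk.convPow_finite_support_and_sum (hμ : IsRandomWalk μ) (n : ℕ) (γ : Γ) :
    (Function.support (convPow μ n γ)).Finite ∧ ∑ᶠ γ', convPow μ n γ γ' = 1 := by
  classical
  induction n generalizing γ with
  | zero =>
    have hsub : Function.support (convPow μ 0 γ) ⊆ ({γ} : Finset Γ) := by
      intro γ' h
      simp only [convPow, Function.mem_support, ne_eq, ite_eq_right_iff, one_ne_zero, imp_false,
        not_not] at h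
      simp [h]
    refine ⟨(Finset.finite_toSet _).subset hsub, ?_⟩
    rw [finsum_eq_sum_of_support_subset _ hsub]
    simp [convPow]
  | succ n ih =>
    set S := (hμ.finite_support γ).toFinset
    set T := S.biUnion fun γ₁ => (ih γ₁).1.toFinset with hT
    have hzero : ∀ γ₁ ∈ S, Function.support (convPow μ n γ₁) ⊆ T := by
      intro γ₁ h₁ γ' h
      simp only [hT, Finset.coe_biUnion, Set.mem_iUnion]
      exact ⟨γ₁, h₁, by simpa using h⟩
    have hsub : Function.support (convPow μ (n + 1) γ) ⊆ T := by
      intro γ' h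
      rw [Function.mem_support, hμ.convPow_succ_eq_sum] at h
      obtain ⟨γ₁, h₁, h₂⟩ := Finset.exists_ne_zero_of_sum_ne_zero h
      exact hzero γ₁ h₁ (right_ne_zero_of_mul h₂)
    refine ⟨(Finset.finite_toSet _).subset hsub, ?_⟩
    rw [finsum_eq_sum_of_support_subset _ hsub]
    simp_rw [hμ.convPow_succ_eq_sum]
    rw [Finset.sum_comm]
    have h1 : ∀ γ₁ ∈ S, ∑ γ' ∈ T, μ γ γ₁ * convPow μ n γ₁ γ' = μ γ γ₁ := by
      intro γ₁ h₁
      rw [← Finset.mul_sum, ← finsum_eq_sum_of_support_subset _ (hzero γ₁ h₁), (ih γ₁).2, mul_one]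
    rw [Finset.sum_congr rfl h1, ← finsum_eq_sum_of_support_subset _ (by simp [S])]
    exact hμ.sum_eq_one γ

variable {Y : Type*} [MetricSpace Y]

/-- The steps of the random walk starting at the identity. -/
noncomputable def IsRandomWalk.steps (hμ : IsRandomWalk μ) : Finset Γ :=
  (hμ.finite_support 1).toFinset

theorem IsRandomWalk.mem_steps (hμ : IsRandomWalk μ) {s : Γ} : s ∈ hμ.steps ↔ μ 1 s ≠ 0 := by
  simp [IsRandomWalk.steps]

theorem IsRandomWalk.sum_steps (hμ : IsRandomWalk μ) : ∑ s ∈ hμ.steps, μ 1 s = 1 := by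
  rw [← finsum_eq_sum_of_support_subset _ (by simp [IsRandomWalk.steps])]
  exact hμ.sum_eq_one 1

theorem IsRandomWalk.apply_inv (hμ : IsRandomWalk μ) (s : Γ) : μ 1 s⁻¹ = μ 1 s := by
  have h := hμ.invariant s 1 s⁻¹
  rw [mul_one, mul_inv_cancel] at h
  rw [← h, hμ.symm]

theorem IsRandomWalk.inv_mem_steps (hμ : IsRandomWalk μ) {s : Γ} (hs : s ∈ hμ.steps) :
    s⁻¹ ∈ hμ.steps := by
  rw [hμ.mem_steps, hμ.apply_inv, ← hμ.mem_steps]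
  exact hs

theorem IsRandomWalk.energy_eq_sum (hμ : IsRandomWalk μ) (f : Γ → Y) :
    energy μ f = 1 / 2 * ∑ s ∈ hμ.steps, μ 1 s * dist (f 1) (f s) ^ 2 := by
  rw [energy, finsum_eq_sum_of_support_subset]
  intro γ h
  simp only [IsRandomWalk.steps, Function.mem_support, Set.Finite.coe_toFinset] at h ⊢
  exact left_ne_zero_of_mul h

/-- The energy is half an average of squared displacements, so a bound of the displacements controls
it for all `n` at once. -/
theorem IsRandomWalk.energy_convPow_le (hμ : IsRandomWalk μ) (n : ℕ) (f : Γ → Y) {D : ℝ}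
    (hD : ∀ γ, dist (f 1) (f γ) ≤ D) : energy (convPow μ n) f ≤ 1 / 2 * D ^ 2 := by
  obtain ⟨hfin, hsum⟩ := hμ.convPow_finite_support_and_sum n 1
  rw [energy, finsum_eq_sum_of_support_subset (s := hfin.toFinset)]
  · have hsum' : ∑ γ ∈ hfin.toFinset, convPow μ n 1 γ = 1 := by
      rw [← finsum_eq_sum_of_support_subset _ (by simp)]
      exact hsum
    refine mul_le_mul_of_nonneg_left ?_ (by norm_num)
    calc ∑ γ ∈ hfin.toFinset, convPow μ n 1 γ * dist (f 1) (f γ) ^ 2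
        ≤ ∑ γ ∈ hfin.toFinset, convPow μ n 1 γ * D ^ 2 :=
          Finset.sum_le_sum fun γ _ => mul_le_mul_of_nonneg_left
            (pow_le_pow_left₀ dist_nonneg (hD γ) 2) (hμ.convPow_nonneg n 1 γ)
      _ = D ^ 2 := by rw [← Finset.sum_mul, hsum', one_mul]
  · intro γ h
    simp only [Function.mem_support, Set.Finite.coe_toFinset] at h ⊢
    exact left_ne_zero_of_mul h

theorem IsEquivariant.apply_eq {ρ : Γ →* (Y ≃ᵢ Y)} {f : Γ → Y} (hf : IsEquivariant ρ f) (γ : Γ) :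
    f γ = ρ γ (f 1) := by
  have := hf γ 1
  rwa [mul_one] at this

/-- Anything that holds at the identity and is stable under right multiplication by steps
holds on the whole group. -/
theorem IsRandomWalk.induction (hμ : IsRandomWalk μ) {P : Γ → Prop} (one : P 1)
    (mul : ∀ γ, ∀ s ∈ hμ.steps, P γ → P (γ * s)) (γ : Γ) : P γ := by
  obtain ⟨n, g, h0, hn, hstep⟩ := hμ.irreducible 1 γ
  have key : ∀ i ≤ n, P (g i) := by
    intro i
    induction i with
    | zero => intro _; rw [h0]; exact one
    | succ i ih =>
      intro hi
      have h := hstep i (by omega)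
      -- Invariance turns an edge of the walk into right multiplication by a step from the identity.
      have h' := hμ.invariant (g i) 1 ((g i)⁻¹ * g (i + 1))
      rw [mul_one, mul_inv_cancel_left] at h'
      rw [h', ← hμ.mem_steps] at h
      have := mul (g i) _ h (ih (by omega))
      rwa [mul_inv_cancel_left] at this
  rw [← hn]
  exact key n le_rfl

/-- A bound of the displacements of each point by its displacement energy gives a bound of the
`n`-step energies. -/
theorem IsRandomWalk.energyBound_of_displacement (hμ : IsRandomWalk μ) (ρ : Γ →* (Y ≃ᵢ Y)) {C : ℝ}
    (h : ∀ y : Y, ∃ D : ℝ, (∀ γ, dist y (ρ γ y) ≤ D) ∧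
      D ^ 2 ≤ C * ∑ s ∈ hμ.steps, μ 1 s * dist y (ρ s y) ^ 2) : EnergyBound μ ρ C := by
  intro n f hf
  obtain ⟨D, h1, h2⟩ := h (f 1)
  refine (hμ.energy_convPow_le n f (D := D) fun γ => ?_).trans ?_
  · rw [hf.apply_eq γ]
    exact h1 γ
  · rw [hμ.energy_eq_sum, Finset.sum_congr rfl fun s _ => by rw [hf.apply_eq s]]
    linarith

/-- Since `C` does not depend on `n`, every `n > C` leaves the slack `n - C`, which serves as ε. -/
theorem EnergyBound.gromovCriterion {ρ : Γ →* (Y ≃ᵢ Y)} {C : ℝ} (h : EnergyBound μ ρ C)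
    (hC : 0 < C) {n : ℕ} (hn : C < n) : GromovCriterion μ ρ n := by
  refine ⟨by exact_mod_cast hC.trans hn, n - C, by linarith, fun f hf => ?_⟩
  rw [sub_sub_cancel]
  exact h n f hf

theorem IsRandomWalk.steps_nonempty (hμ : IsRandomWalk μ) : hμ.steps.Nonempty := by
  by_contra h
  have := hμ.sum_steps
  rw [Finset.not_nonempty_iff_eq_empty.1 h] at this
  simp at this

/-- The least positive transition probability. -/
theorem IsRandomWalk.exists_isLeast (hμ : IsRandomWalk μ) :
    ∃ m : ℝ, IsLeast (μ 1 '' {s : Γ | μ 1 s ≠ 0}) m ∧ 0 < m := by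
  obtain ⟨s, hs, hmin⟩ := hμ.steps.exists_min_image (μ 1) hμ.steps_nonempty
  refine ⟨μ 1 s, ⟨⟨s, hμ.mem_steps.1 hs, rfl⟩, ?_⟩,
    lt_of_le_of_ne (hμ.nonneg _ _) (hμ.mem_steps.1 hs).symm⟩
  rintro _ ⟨t, ht, rfl⟩
  exact hmin t (hμ.mem_steps.2 ht)

end RandomWalk

/-! ### Isometries of ℝ-trees with a fixed point -/

section Tree

variable {Y : Type*} [MetricSpace Y]

/-- Values outside the unit interval are arbitrary; extending by constants gives global continuity,
needed for closed fixed sets of parameters and for splicing paths. -/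
theorem IsGeodesic.exists_continuous {c : ℝ → Y} {p q : Y} (h : IsGeodesic c p q) :
    ∃ c' : ℝ → Y, Continuous c' ∧ IsGeodesic c' p q := by
  refine ⟨Set.IccExtend (zero_le_one' ℝ) (Set.domRestrict (Set.Icc 0 1) c),
    (continuousOn_iff_continuous_domRestrict.1 h.continuousOn).Icc_extend', ?_, ?_, ?_⟩
  · rw [Set.IccExtend_of_mem _ _ (by simp)]
    exact h.map_zero
  · rw [Set.IccExtend_of_mem _ _ (by simp)]
    exact h.map_one
  · intro s hs t ht
    rw [Set.IccExtend_of_mem _ _ hs, Set.IccExtend_of_mem _ _ ht]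
    exact h.dist_eq s hs t ht

theorem IsGeodesic.initial {c : ℝ → Y} {p q : Y} (h : IsGeodesic c p q) {r : ℝ}
    (hr : r ∈ Set.Icc (0 : ℝ) 1) : IsGeodesic (fun t => c (r * t)) p (c r) where
  map_zero := by rw [mul_zero, h.map_zero]
  map_one := by rw [mul_one]
  dist_eq s hs t ht := by
    rw [h.dist_eq _ ⟨mul_nonneg hr.1 hs.1, mul_le_one₀ hr.2 hs.1 hs.2⟩ _
      ⟨mul_nonneg hr.1 ht.1, mul_le_one₀ hr.2 ht.1 ht.2⟩, h.dist_left hr, ← mul_sub, abs_mul,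
      abs_of_nonneg hr.1]
    ring

/-- In an `ℝ`-tree, every arc runs along the geodesic. -/
theorem IsRTree.dist_add_dist (hY : IsRTree Y) {x z : Y} (γ : Path x z)
    (hγ : Function.Injective γ) (t : unitInterval) : dist x (γ t) + dist (γ t) z = dist x z := by
  obtain ⟨c, hc, hc'⟩ := hY x z
  have h : γ t ∈ c '' Set.Icc (0 : ℝ) 1 := hc' γ hγ ▸ Set.mem_range_self t
  obtain ⟨u, hu, hu'⟩ := h
  rw [← hu', hc.dist_left hu, hc.dist_right hu]
  ring

/-- Both geodesics are arcs, hence have the same image, and the distance from `x` recovers the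
parameter of a point on either. -/
theorem IsRTree.geodesic_unique (hY : IsRTree Y) {x z : Y} {c c' : ℝ → Y} (hc : IsGeodesic c x z)
    (hc' : IsGeodesic c' x z) {t : ℝ} (ht : t ∈ Set.Icc (0 : ℝ) 1) : c t = c' t := by
  rcases eq_or_ne x z with rfl | hne
  · have h1 := hc.dist_left ht
    have h2 := hc'.dist_left ht
    rw [dist_self, mul_zero, dist_eq_zero] at h1 h2
    rw [← h1, ← h2]
  have hpos : dist x z ≠ 0 := dist_ne_zero.2 hne
  have arc : ∀ {b : ℝ → Y}, IsGeodesic b x z →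
      ∃ γ : Path x z, Function.Injective γ ∧ Set.range γ = b '' Set.Icc (0 : ℝ) 1 := by
    intro b hb
    refine ⟨⟨⟨fun t => b t, continuousOn_iff_continuous_domRestrict.1 hb.continuousOn⟩,
      hb.map_zero, hb.map_one⟩, ?_, ?_⟩
    · intro s t hst
      have h1 := hb.dist_left s.2
      have h2 := hb.dist_left t.2
      have h3 : b s = b t := hst
      rw [h3, h2] at h1
      exact Subtype.ext (mul_right_cancel₀ hpos h1).symm
    · ext w
      simp only [Set.mem_range, Set.mem_image]
      exact ⟨fun ⟨u, hu⟩ => ⟨u, u.2, hu⟩, fun ⟨u, hu, hu'⟩ => ⟨⟨u, hu⟩, hu'⟩⟩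
  obtain ⟨a, -, ha⟩ := hY x z
  obtain ⟨γ, hγ, hγ'⟩ := arc hc
  obtain ⟨γ₂, hγ₂, hγ₂'⟩ := arc hc'
  have himage : c '' Set.Icc (0 : ℝ) 1 = c' '' Set.Icc (0 : ℝ) 1 := by
    rw [← hγ', ← hγ₂', ha γ hγ, ha γ₂ hγ₂]
  obtain ⟨u, hu, hu'⟩ : c t ∈ c' '' Set.Icc (0 : ℝ) 1 := himage ▸ ⟨t, ht, rfl⟩
  have h1 := hc.dist_left ht
  rw [← hu', hc'.dist_left hu] at h1
  rw [← hu', mul_right_cancel₀ hpos h1]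

/-- The displacement of an isometry of an `ℝ`-tree fixing `p` is twice the length of the part of
the geodesic from `p` that is not fixed. -/
theorem IsRTree.exists_fixed_initial (hY : IsRTree Y) {p y : Y} {c : ℝ → Y}
    (hcont : Continuous c) (hc : IsGeodesic c p y) (g : Y ≃ᵢ Y) (hg : g p = p) :
    ∃ t₀ ∈ Set.Icc (0 : ℝ) 1, (∀ t ∈ Set.Icc 0 t₀, g (c t) = c t) ∧
      dist y (g y) = 2 * ((1 - t₀) * dist p y) := by
  rcases eq_or_ne p y with rfl | hne
  · refine ⟨1, by simp, fun t ht => ?_, by simp [hg]⟩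
    have h1 := hc.dist_left ht
    rw [dist_self, mul_zero, dist_eq_zero] at h1
    rw [← h1, hg]
  have hpos : dist p y ≠ 0 := dist_ne_zero.2 hne
  have hcompact : IsCompact (Set.Icc (0 : ℝ) 1 ∩ {t | g (c t) = c t}) :=
    isCompact_Icc.inter_right (isClosed_eq (g.continuous.comp hcont) hcont)
  obtain ⟨t₀, ⟨ht₀, hfix⟩, hmax⟩ := hcompact.exists_isGreatest
    ⟨0, by simp, by simp [hc.map_zero, hg]⟩
  simp only [Set.mem_ofPred_eq] at hfix
  refine ⟨t₀, ht₀, fun t ht => ?_, ?_⟩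
  · rcases ht₀.1.eq_or_lt with h0 | h0
    · have : t = t₀ := le_antisymm ht.2 (by rw [← h0]; exact ht.1)
      rw [this, hfix]
    · have h1 := hc.initial ht₀
      have h2 := h1.comp_isometry g
      rw [hg, hfix] at h2
      have h3 := hY.geodesic_unique h2 h1 (t := t / t₀)
        ⟨div_nonneg ht.1 h0.le, (div_le_one h0).2 ht.2⟩
      rwa [mul_div_cancel₀ _ h0.ne'] at h3
  · rcases ht₀.2.eq_or_lt with h1 | h1
    · rw [h1, hc.map_one] at hfix
      rw [hfix, h1]
      simp
    -- The path `σ` runs back along `c` from `y` to the last fixed point `c t₀`, then along `g ∘ c`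
    -- to `g y`. It is an arc, so `c t₀` lies on the geodesic from `y` to `g y`, and the two halves
    -- have equal length.
    set r : ℝ → ℝ := fun u => t₀ + (1 - t₀) * |2 * u - 1| with hr
    have hrmem : ∀ u ∈ Set.Icc (0 : ℝ) 1, r u ∈ Set.Icc (0 : ℝ) 1 := by
      intro u hu
      have h2 : |2 * u - 1| ≤ 1 := abs_le.2 ⟨by linarith [hu.1], by linarith [hu.2]⟩
      have h3 := mul_nonneg (sub_nonneg.2 h1.le) (abs_nonneg (2 * u - 1))
      have h4 := mul_le_mul_of_nonneg_left h2 (sub_nonneg.2 h1.le)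
      exact ⟨add_nonneg ht₀.1 h3, by simp only [hr]; linarith⟩
    set σ : ℝ → Y := fun u => if u ≤ 1 / 2 then c (r u) else g (c (r u)) with hσ
    have hrcont : Continuous r := by fun_prop
    have hσcont : Continuous σ := by
      refine Continuous.if_le (hcont.comp hrcont) (g.continuous.comp (hcont.comp hrcont))
        continuous_id continuous_const fun u hu => ?_
      have : r u = t₀ := by simp [hr, hu]
      simp only [this, hfix]
    have hσ0 : σ 0 = y := by
      have : r 0 = 1 := by simp [hr]
      simp [hσ, this, hc.map_one]
    have hσ1 : σ 1 = g y := by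
      have : r 1 = 1 := by simp only [hr]; norm_num
      simp only [hσ, this, hc.map_one]
      norm_num
    have hdist : ∀ u ∈ Set.Icc (0 : ℝ) 1, dist p (σ u) = r u * dist p y := by
      intro u hu
      simp only [hσ]
      split_ifs
      · exact hc.dist_left (hrmem u hu)
      · conv_lhs => rw [← hg]
        rw [g.dist_eq]
        exact hc.dist_left (hrmem u hu)
    have hcontra : ∀ u ∈ Set.Icc (0 : ℝ) 1, u ≠ 1 / 2 → c (r u) ≠ g (c (r u)) := by
      intro u hu hu' heq
      have h2 : r u ≤ t₀ := hmax ⟨hrmem u hu, heq.symm⟩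
      have h3 : 0 < |2 * u - 1| := abs_pos.2 fun h => hu' (by linarith)
      have := mul_pos (sub_pos.2 h1) h3
      simp only [hr] at h2
      linarith
    -- The distance from `p` determines `r u`. Two parameters with the same `r` on opposite branches
    -- would make `c (r u)` fixed by `g`, against the maximality of `t₀`.
    have hinj : ∀ u ∈ Set.Icc (0 : ℝ) 1, ∀ v ∈ Set.Icc (0 : ℝ) 1, σ u = σ v → u = v := by
      intro u hu v hv huv
      have h2 : r u = r v := by
        have := hdist u hu
        rw [huv, hdist v hv] at this
        exact (mul_right_cancel₀ hpos this).symm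
      have h3 : |2 * u - 1| = |2 * v - 1| := by
        simp only [hr] at h2
        exact mul_left_cancel₀ (sub_pos.2 h1).ne' (add_left_cancel h2)
      rcases abs_eq_abs.1 h3 with h4 | h4
      · linarith
      · by_contra hne
        simp only [hσ, h2] at huv
        have hv' : v ≠ 1 / 2 := fun h => hne (by linarith)
        split_ifs at huv with h5 h6
        · exact hv' (by linarith)
        · exact hcontra v hv hv' huv
        · exact hcontra v hv hv' huv.symm
        · linarith
    let γ : Path y (g y) := ⟨⟨fun u => σ u, hσcont.comp continuous_subtype_val⟩, hσ0, hσ1⟩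
    have hkey := hY.dist_add_dist γ (fun u v h => Subtype.ext (hinj u u.2 v v.2 h))
      ⟨1 / 2, by norm_num, by norm_num⟩
    have hhalf : γ ⟨1 / 2, by norm_num, by norm_num⟩ = c t₀ := by
      change σ (1 / 2) = c t₀
      simp [hσ, hr]
    rw [hhalf] at hkey
    have h5 : dist (c t₀) (g y) = dist (c t₀) y := by
      conv_lhs => rw [← hfix]
      exact g.dist_eq _ _
    rw [h5, dist_comm y, hc.dist_right ht₀] at hkey
    linarith

variable {Γ : Type*} [Group Γ] {μ : Γ → Γ → ℝ}

/-- For an action on an `ℝ`-tree with a fixed point, the displacements of a point are bounded by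
the displacement under some step of the random walk. -/
theorem IsRTree.exists_step_displacement (hY : IsRTree Y) (hμ : IsRandomWalk μ)
    {ρ : Γ →* (Y ≃ᵢ Y)} (hfix : ∃ p : Y, ∀ γ : Γ, ρ γ p = p) (y : Y) :
    ∃ s ∈ hμ.steps, ∀ γ, dist y (ρ γ y) ≤ dist y (ρ s y) := by
  obtain ⟨p, hp⟩ := hfix
  obtain ⟨c₀, hc₀, -⟩ := hY p y
  obtain ⟨c, hcont, hc⟩ := hc₀.exists_continuous
  choose t ht hinit hdisp using fun s => hY.exists_fixed_initial hcont hc (ρ s) (hp s)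
  obtain ⟨s, hs, hmin⟩ := hμ.steps.exists_min_image t hμ.steps_nonempty
  -- The shortest fixed piece lies inside the piece fixed by every step, so its endpoint is fixed by
  -- all steps and hence by the group.
  have hfixed : ∀ γ, ρ γ (c (t s)) = c (t s) := by
    refine hμ.induction ?_ fun γ s' hs' ih => ?_
    · rw [map_one]; rfl
    · rw [map_mul, IsometryEquiv.mul_apply, hinit s' _ ⟨(ht s).1, hmin s' hs'⟩, ih]
  refine ⟨s, hs, fun γ => ?_⟩
  have h1 : dist (c (t s)) (ρ γ y) = dist (c (t s)) y := by
    conv_lhs => rw [← hfixed γ]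
    exact (ρ γ).dist_eq _ _
  have h2 := dist_triangle y (c (t s)) (ρ γ y)
  rw [h1, dist_comm y (c (t s)), hc.dist_right (ht s)] at h2
  rw [hdisp s]
  linarith

theorem IsRTree.energyBound (hY : IsRTree Y) (hμ : IsRandomWalk μ) {ρ : Γ →* (Y ≃ᵢ Y)}
    (hfix : ∃ p : Y, ∀ γ : Γ, ρ γ p = p) {m : ℝ}
    (hm : IsLeast (μ 1 '' {s : Γ | μ 1 s ≠ 0}) m) (hpos : 0 < m) : EnergyBound μ ρ m⁻¹ := by
  refine hμ.energyBound_of_displacement ρ fun y => ?_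
  obtain ⟨s, hs, hle⟩ := hY.exists_step_displacement hμ hfix y
  refine ⟨dist y (ρ s y), hle, ?_⟩
  rw [← div_eq_inv_mul, le_div_iff₀ hpos]
  calc dist y (ρ s y) ^ 2 * m ≤ μ 1 s * dist y (ρ s y) ^ 2 := by
        rw [mul_comm]
        exact mul_le_mul_of_nonneg_right (hm.2 ⟨s, hμ.mem_steps.1 hs, rfl⟩) (sq_nonneg _)
    _ ≤ _ := Finset.single_le_sum (f := fun s => μ 1 s * dist y (ρ s y) ^ 2)
        (fun s' _ => mul_nonneg (hμ.nonneg _ _) (sq_nonneg _)) hs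

end Tree

/-! ### Linearization of almost isometric maps -/

section Linearization

variable {E : Type*} [NormedAddCommGroup E] [InnerProductSpace ℝ E]

/-- A map fixing the origin that is nearly isometric on balls nearly preserves inner products. -/
theorem abs_inner_sub_inner_le {f : E → E} {κ r : ℝ} (h0 : f 0 = 0) (hκ : 0 ≤ κ)
    (hr : 0 ≤ r) (hκr : κ * r ≤ 1)
    (hf : ∀ u v, ‖u‖ ≤ r → ‖v‖ ≤ r → |‖f u - f v‖ - ‖u - v‖| ≤ κ * r * ‖u - v‖) {u v : E}
    (hu : ‖u‖ ≤ r) (hv : ‖v‖ ≤ r) : |inner ℝ (f u) (f v) - inner ℝ u v| ≤ 9 * (κ * r ^ 3) := by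
  have hκr0 : 0 ≤ κ * r := mul_nonneg hκ hr
  have key : ∀ x y : E, ‖x‖ ≤ r → ‖y‖ ≤ r → ∀ b, ‖x - y‖ ≤ b →
      |‖f x - f y‖ ^ 2 - ‖x - y‖ ^ 2| ≤ 3 * (κ * r * b ^ 2) := by
    intro x y hx hy b hb
    have h1 := hf x y hx hy
    have hn := norm_nonneg (x - y)
    have h2 : ‖f x - f y‖ + ‖x - y‖ ≤ 3 * ‖x - y‖ := by
      have := (abs_le.1 h1).2
      nlinarith
    rw [sq_sub_sq, abs_mul, abs_of_nonneg (by positivity)]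
    calc (‖f x - f y‖ + ‖x - y‖) * |‖f x - f y‖ - ‖x - y‖|
        ≤ (3 * ‖x - y‖) * (κ * r * ‖x - y‖) :=
          mul_le_mul h2 h1 (abs_nonneg _) (by positivity)
      _ = 3 * (κ * r * ‖x - y‖ ^ 2) := by ring
      _ ≤ _ := by gcongr
  have zero_le : ‖(0 : E)‖ ≤ r := by simpa using hr
  have e1 := key u 0 hu zero_le r (by simpa using hu)
  have e2 := key v 0 hv zero_le r (by simpa using hv)
  have e3 := key u v hu hv (2 * r) ((norm_sub_le u v).trans (by linarith))
  rw [h0, sub_zero, sub_zero] at e1 e2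
  -- Polarization: the three squared norms have errors 3, 3 and 12 times `κ * r ^ 3`; half the total
  -- is 9.
  have i1 := norm_sub_sq_real (f u) (f v)
  have i2 := norm_sub_sq_real u v
  have e4 : κ * r * (2 * r) ^ 2 = 4 * (κ * r ^ 3) := by ring
  have e5 : κ * r * r ^ 2 = κ * r ^ 3 := by ring
  rw [e4] at e3
  rw [e5] at e1 e2
  rw [abs_le] at e1 e2 e3 ⊢
  constructor <;> linarith [e1.1, e1.2, e2.1, e2.2, e3.1, e3.2]

/-- A map fixing the origin whose distortion on the ball of radius `r` is `O(r)` is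
differentiable at the origin, with an isometric derivative. -/
theorem exists_linearIsometry_approx [CompleteSpace E] {f : E → E} {κ R : ℝ} (h0 : f 0 = 0)
    (hκ : 0 ≤ κ) (hR : 0 < R) (hκR : κ * R ≤ 1)
    (hf : ∀ r ≤ R, ∀ u v, ‖u‖ ≤ r → ‖v‖ ≤ r → |‖f u - f v‖ - ‖u - v‖| ≤ κ * r * ‖u - v‖) :
    ∃ A : E →ₗᵢ[ℝ] E, ∀ u, ‖u‖ ≤ R → ‖f u - A u‖ ≤ 32 * (‖u‖ * √(κ * ‖u‖)) := by
  -- Expanding the square, the exact inner products cancel. What remains is at most 9(1 + 1/2 +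
  -- 1/16) ≤ 16 times `κ * ‖u‖ ^ 3`, whose root gives the factor 4.
  have quarter : ∀ u, ‖u‖ ≤ R →
      ‖f ((1 / 4 : ℝ) • u) - (1 / 4 : ℝ) • f u‖ ≤ 4 * (‖u‖ * √(κ * ‖u‖)) := by
    intro u hu
    have hu0 := norm_nonneg u
    have hκu : κ * ‖u‖ ≤ 1 := (mul_le_mul_of_nonneg_left hu hκ).trans hκR
    have hw : ‖(1 / 4 : ℝ) • u‖ ≤ ‖u‖ := by
      rw [norm_smul, Real.norm_of_nonneg (by norm_num)]
      linarith
    have b := fun {x y : E} => abs_inner_sub_inner_le h0 hκ hu0 hκu (hf _ hu) (u := x) (v := y)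
    have b1 := b hw hw
    have b2 := b hw le_rfl
    have b3 := b (x := u) le_rfl le_rfl
    have e1 := norm_sub_sq_real (f ((1 / 4 : ℝ) • u)) ((1 / 4 : ℝ) • f u)
    simp only [real_inner_self_eq_norm_sq, real_inner_smul_left, real_inner_smul_right, norm_smul,
      mul_pow] at b1 b2 b3 e1
    norm_num at b1 b2 b3 e1
    refine abs_le_of_sq_le_sq' ?_ (by positivity) |>.2
    rw [mul_pow, mul_pow, Real.sq_sqrt (by positivity)]
    norm_num
    rw [e1]
    rw [abs_le] at b1 b2 b3
    have : 0 ≤ κ * ‖u‖ ^ 3 := by positivity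
    rw [show ‖u‖ ^ 2 * (κ * ‖u‖) = κ * ‖u‖ ^ 3 by ring]
    linarith [b1.1, b1.2, b2.1, b2.2, b3.1, b3.2]
  -- The derivative is the limit of these rescalings. The ratio 1/4 is convenient because the
  -- remainder scales by its square root, so the increments decay like powers of 1/2.
  set a : E → ℕ → E := fun u k => (4 : ℝ) ^ k • f ((1 / 4 : ℝ) ^ k • u) with ha
  have hpow : ∀ k : ℕ, (0 : ℝ) < (1 / 4) ^ k := fun k => by positivity
  have hpow1 : ∀ k : ℕ, (1 / 4 : ℝ) ^ k ≤ 1 := fun k => pow_le_one₀ (by norm_num) (by norm_num)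
  have h41 : ∀ k : ℕ, (4 : ℝ) ^ k * (1 / 4) ^ k = 1 := fun k => by
    rw [← mul_pow]; norm_num
  have step : ∀ u, ‖u‖ ≤ R → ∀ k,
      dist (a u k) (a u (k + 1)) ≤ 32 * (‖u‖ * √(κ * ‖u‖)) / 2 / 2 ^ k := by
    intro u hu k
    have hsc : ‖(1 / 4 : ℝ) ^ k • u‖ = (1 / 4) ^ k * ‖u‖ := by
      rw [norm_smul, Real.norm_of_nonneg (hpow k).le]
    have h1 := quarter ((1 / 4 : ℝ) ^ k • u) (by
      rw [hsc]
      exact (mul_le_of_le_one_left (norm_nonneg _) (hpow1 k)).trans hu)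
    rw [hsc, smul_smul, ← pow_succ'] at h1
    have h2 : √(κ * ((1 / 4) ^ k * ‖u‖)) = (1 / 2) ^ k * √(κ * ‖u‖) := by
      rw [show κ * ((1 / 4 : ℝ) ^ k * ‖u‖) = ((1 / 2) ^ k) ^ 2 * (κ * ‖u‖) by
        rw [← pow_mul, mul_comm k 2, pow_mul]; norm_num; ring]
      rw [Real.sqrt_mul (by positivity), Real.sqrt_sq (by positivity)]
    rw [dist_comm, dist_eq_norm]
    have h3 : a u (k + 1) - a u k = (4 : ℝ) ^ (k + 1) •
        (f ((1 / 4 : ℝ) ^ (k + 1) • u) - (1 / 4 : ℝ) • f ((1 / 4 : ℝ) ^ k • u)) := by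
      simp only [ha]
      rw [smul_sub, smul_smul, pow_succ, mul_assoc]
      norm_num
    rw [h3, norm_smul, Real.norm_of_nonneg (by positivity)]
    calc (4 : ℝ) ^ (k + 1) * _ ≤ 4 ^ (k + 1) *
          (4 * ((1 / 4) ^ k * ‖u‖ * √(κ * ((1 / 4) ^ k * ‖u‖)))) := by gcongr
      _ = (4 ^ k * (1 / 4) ^ k) * (16 * (‖u‖ * √(κ * ‖u‖))) * (1 / 2) ^ k := by
        rw [h2]; ring
      _ = _ := by rw [h41, one_div, inv_pow]; ring
  have hlim : ∀ u, ∃ l, Tendsto (a u) atTop (𝓝 l) ∧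
      (‖u‖ ≤ R → ‖f u - l‖ ≤ 32 * (‖u‖ * √(κ * ‖u‖))) := by
    have small : ∀ u, ‖u‖ ≤ R → ∃ l, Tendsto (a u) atTop (𝓝 l) := fun u hu =>
      cauchySeq_tendsto_of_complete (cauchySeq_of_le_geometric_two (step u hu))
    intro u
    by_cases hu : ‖u‖ ≤ R
    · obtain ⟨l, hl⟩ := small u hu
      refine ⟨l, hl, fun _ => ?_⟩
      have := dist_le_of_le_geometric_two_of_tendsto₀ (step u hu) hl
      rw [dist_eq_norm] at this
      simpa [ha] using this
    -- Outside the ball the sequence is a shifted multiple of the one for a small multiple of `u`,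
    -- so the limit exists on all of `E`.
    · have ht : Tendsto (fun k : ℕ => (1 / 4 : ℝ) ^ k * ‖u‖) atTop (𝓝 (0 * ‖u‖)) :=
        (tendsto_pow_atTop_nhds_zero_of_lt_one (by norm_num) (by norm_num)).mul_const _
      rw [zero_mul] at ht
      obtain ⟨N, hN⟩ := (ht.eventually (ge_mem_nhds hR)).exists
      obtain ⟨l, hl⟩ := small ((1 / 4 : ℝ) ^ N • u) (by
        rw [norm_smul, Real.norm_of_nonneg (hpow N).le]
        exact hN)
      refine ⟨(4 : ℝ) ^ N • l, ?_, fun h => absurd h hu⟩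
      refine (tendsto_add_atTop_iff_nat N).1 ?_
      refine (hl.const_smul ((4 : ℝ) ^ N)).congr fun k => ?_
      simp only [ha, smul_smul, ← pow_add]
      rw [add_comm N k]
  choose A hA hA' using hlim
  -- At scale `(1 / 4) ^ k` the relative distortion is O((1 / 4) ^ k), so it disappears in the
  -- limit.
  have hiso : Isometry A := by
    refine Isometry.of_dist_eq fun u v => ?_
    rw [dist_eq_norm, dist_eq_norm]
    refine tendsto_nhds_unique ((hA u).sub (hA v)).norm ?_
    set M := max ‖u‖ ‖v‖ with hM
    have ht : Tendsto (fun k : ℕ => (1 / 4 : ℝ) ^ k * M) atTop (𝓝 (0 * M)) :=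
      (tendsto_pow_atTop_nhds_zero_of_lt_one (by norm_num) (by norm_num)).mul_const _
    have hbound : Tendsto (fun k : ℕ => κ * ((1 / 4 : ℝ) ^ k * M) * ‖u - v‖) atTop
        (𝓝 (κ * (0 * M) * ‖u - v‖)) := (ht.const_mul κ).mul_const _
    rw [zero_mul] at ht
    rw [zero_mul, mul_zero, zero_mul] at hbound
    rw [tendsto_iff_dist_tendsto_zero]
    refine squeeze_zero' (Eventually.of_forall fun _ => dist_nonneg) ?_ hbound
    filter_upwards [ht.eventually (ge_mem_nhds hR)] with k hk
    have hsc : ∀ x : E, ‖(1 / 4 : ℝ) ^ k • x‖ = (1 / 4) ^ k * ‖x‖ := fun x => by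
      rw [norm_smul, Real.norm_of_nonneg (hpow k).le]
    have h1 := hf _ hk ((1 / 4 : ℝ) ^ k • u) ((1 / 4 : ℝ) ^ k • v)
      (by rw [hsc]; exact mul_le_mul_of_nonneg_left (le_max_left _ _) (hpow k).le)
      (by rw [hsc]; exact mul_le_mul_of_nonneg_left (le_max_right _ _) (hpow k).le)
    rw [← smul_sub, hsc] at h1
    have h2 : ‖a u k - a v k‖ - ‖u - v‖ = 4 ^ k *
        (‖f ((1 / 4 : ℝ) ^ k • u) - f ((1 / 4 : ℝ) ^ k • v)‖ - (1 / 4) ^ k * ‖u - v‖) := by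
      simp only [ha]
      rw [← smul_sub, norm_smul, Real.norm_of_nonneg (by positivity), mul_sub, ← mul_assoc, h41,
        one_mul]
    rw [Real.dist_eq, h2, abs_mul, abs_of_nonneg (by positivity)]
    calc (4 : ℝ) ^ k * _ ≤ 4 ^ k * (κ * ((1 / 4) ^ k * M) * ((1 / 4) ^ k * ‖u - v‖)) := by gcongr
      _ = (4 ^ k * (1 / 4) ^ k) * (κ * ((1 / 4) ^ k * M) * ‖u - v‖) := by ring
      _ = _ := by rw [h41, one_mul]
  have hA0 : A 0 = 0 := by
    refine tendsto_nhds_unique (hA 0) ?_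
    simp [ha, h0]
  -- An isometry into a strictly convex space is affine; fixing 0, it agrees with its linear part.
  refine ⟨hiso.affineIsometryOfStrictConvexSpace.linearIsometry, fun u hu => ?_⟩
  have h1 := hiso.affineIsometryOfStrictConvexSpace.map_vadd 0 u
  simp only [vadd_eq_add, add_zero, Isometry.coe_affineIsometryOfStrictConvexSpace, hA0] at h1
  rw [← h1]
  exact hA' u hu

theorem hasFDerivAt_of_norm_sub_le {f : E → E} {A : E →L[ℝ] E} {C R : ℝ} (hR : 0 < R)
    (h0 : f 0 = 0) (hf : ∀ u, ‖u‖ ≤ R → ‖f u - A u‖ ≤ C * (‖u‖ * √‖u‖)) :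
    HasFDerivAt f A 0 := by
  rw [hasFDerivAt_iff_isLittleO_nhds_zero]
  simp only [zero_add, h0, sub_zero]
  have h1 : Tendsto (fun u : E => C * √‖u‖) (𝓝 0) (𝓝 0) := by
    have : Continuous fun u : E => C * √‖u‖ := by fun_prop
    simpa using this.tendsto 0
  refine Asymptotics.isLittleO_iff.2 fun ε hε => ?_
  filter_upwards [h1.eventually (ge_mem_nhds hε), Metric.closedBall_mem_nhds (0 : E) hR]
    with u hu hu'
  refine (hf u (by simpa using hu')).trans ?_
  calc C * (‖u‖ * √‖u‖) = C * √‖u‖ * ‖u‖ := by ring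
    _ ≤ ε * ‖u‖ := by gcongr

end Linearization

/-! ### Fixed points of bounded linear actions, and intertwiners -/

section Averaging

variable {Γ : Type*} [Group Γ]

/-- A bounded linear action on a finite-dimensional space has a fixed point in every nonempty
closed convex invariant set. -/
theorem exists_fixed_of_bounded_action {W : Type*} [NormedAddCommGroup W] [NormedSpace ℝ W]
    [FiniteDimensional ℝ W] (T : Γ → W →L[ℝ] W) (hone : ∀ x, T 1 x = x)
    (hmul : ∀ γ γ' x, T (γ * γ') x = T γ (T γ' x)) {M : ℝ} (hM : ∀ γ, ‖T γ‖ ≤ M) {K : Set W}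
    (hne : K.Nonempty) (hclosed : IsClosed K) (hconv : Convex ℝ K)
    (hinv : ∀ γ, ∀ x ∈ K, T γ x ∈ K) : ∃ x ∈ K, ∀ γ, T γ x = x := by
  have : CompleteSpace W := FiniteDimensional.complete ℝ W
  have hM0 : 0 ≤ M := (norm_nonneg _).trans (hM 1)
  set Φ : W ≃L[ℝ] EuclideanSpace ℝ (Fin (Module.finrank ℝ W)) := toEuclidean (E := W)
  set B := ‖(Φ : W →L[ℝ] EuclideanSpace ℝ (Fin (Module.finrank ℝ W)))‖
  set B' := ‖(Φ.symm : EuclideanSpace ℝ (Fin (Module.finrank ℝ W)) →L[ℝ] W)‖ + 1 with hB'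
  have hB'pos : 0 < B' := by positivity
  -- The norm of `W` need not be convex enough, so orbits are measured in a Euclidean norm. The
  -- parallelogram law, with the bound for the inverses, makes `g` uniformly convex, and `g` does
  -- not increase under the action; its unique minimizer is therefore fixed.
  set g : W → ℝ := fun x => ⨆ γ, ‖Φ (T γ x)‖ ^ 2 with hg
  have hbdd : ∀ x, BddAbove (Set.range fun γ => ‖Φ (T γ x)‖ ^ 2) := by
    intro x
    refine ⟨(B * (M * ‖x‖)) ^ 2, ?_⟩
    rintro _ ⟨γ, rfl⟩
    refine pow_le_pow_left₀ (norm_nonneg _) ?_ 2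
    refine ((Φ : W →L[ℝ] EuclideanSpace ℝ (Fin (Module.finrank ℝ W))).le_opNorm _).trans ?_
    exact mul_le_mul_of_nonneg_left ((T γ).le_of_opNorm_le (hM γ) x) (norm_nonneg _)
  have hle : ∀ x γ, ‖Φ (T γ x)‖ ^ 2 ≤ g x := fun x γ => le_ciSup (hbdd x) γ
  have hlow : ∀ x γ, ‖x‖ ≤ (M + 1) * B' * ‖Φ (T γ x)‖ := by
    intro x γ
    have h1 : x = T γ⁻¹ (Φ.symm (Φ (T γ x))) := by
      rw [Φ.symm_apply_apply, ← hmul, inv_mul_cancel, hone]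
    conv_lhs => rw [h1]
    refine ((T γ⁻¹).le_of_opNorm_le (hM γ⁻¹) _).trans ?_
    have h2 : ‖Φ.symm (Φ (T γ x))‖ ≤ B' * ‖Φ (T γ x)‖ :=
      (Φ.symm : EuclideanSpace ℝ (Fin (Module.finrank ℝ W)) →L[ℝ] W).le_of_opNorm_le (by simp [hB']) _
    calc M * _ ≤ (M + 1) * (B' * ‖Φ (T γ x)‖) := by gcongr; linarith
      _ = _ := by ring
  obtain ⟨x, hx, -, huniq⟩ := exists_unique_minimizer hne (g := g)
    (fun x _ => (sq_nonneg _).trans (hle x 1)) (κ := 1 / 4 / ((M + 1) * B') ^ 2) (by positivity)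
    (fun a ha b hb => by
      refine ⟨(1 / 2 : ℝ) • a + (1 / 2 : ℝ) • b,
        hconv ha hb (by norm_num) (by norm_num) (by norm_num), ciSup_le fun γ => ?_⟩
      have h1 := parallelogram_law_with_norm ℝ ((1 / 2 : ℝ) • Φ (T γ a)) ((1 / 2 : ℝ) • Φ (T γ b))
      rw [← smul_sub, ← map_sub, ← map_sub, norm_smul, norm_smul, norm_smul] at h1
      have h2 : dist a b ^ 2 ≤ ((M + 1) * B') ^ 2 * ‖Φ (T γ (a - b))‖ ^ 2 := by
        rw [dist_eq_norm, ← mul_pow]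
        exact pow_le_pow_left₀ (norm_nonneg _) (hlow _ γ) 2
      have h3 : 1 / 4 / ((M + 1) * B') ^ 2 * dist a b ^ 2 ≤ 1 / 4 * ‖Φ (T γ (a - b))‖ ^ 2 := by
        rw [div_mul_eq_mul_div, div_le_iff₀ (by positivity)]
        linarith
      simp only [map_add, map_smul]
      generalize Φ (T γ (a - b)) = z at h1 h3
      norm_num at h1
      linarith [hle a γ, hle b γ])
    (fun c => by
      have : {x | x ∈ K ∧ g x ≤ c} = K ∩ ⋂ γ, {x | ‖Φ (T γ x)‖ ^ 2 ≤ c} := by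
        ext x
        simp only [Set.mem_ofPred_eq, Set.mem_inter_iff, Set.mem_iInter]
        exact and_congr_right fun _ => ⟨fun h γ => (hle x γ).trans h, fun h => ciSup_le h⟩
      rw [this]
      exact hclosed.inter (isClosed_iInter fun γ => isClosed_le (by fun_prop) continuous_const))
  refine ⟨x, hx, fun γ => huniq _ (hinv γ x hx) (ciSup_le fun γ' => ?_)⟩
  have h := hle x (γ' * γ)
  rwa [hmul] at h

/-- Two bounded representations on a finite-dimensional space that are uniformly close are
equivalent. -/
theorem exists_intertwiner {E : Type*} [NormedAddCommGroup E] [NormedSpace ℝ E]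
    [FiniteDimensional ℝ E] (σ σ' : Γ →* (E →L[ℝ] E)) {M ε : ℝ} (hM : ∀ γ, ‖σ γ‖ ≤ M)
    (hM' : ∀ γ, ‖σ' γ‖ ≤ M) (hε : ∀ γ, ‖σ' γ - σ γ‖ ≤ ε) (hεM : ε * M < 1) :
    ∃ T : E ≃L[ℝ] E, ∀ γ v, σ' γ (T v) = T (σ γ v) := by
  have : CompleteSpace E := FiniteDimensional.complete ℝ E
  have hM0 : 0 ≤ M := (norm_nonneg _).trans (hM 1)
  have hε0 : 0 ≤ ε := (norm_nonneg _).trans (hε 1)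
  -- A fixed point of this action on operators is an intertwiner. The set `K` used below contains 1,
  -- and its elements lie within `ε * M < 1` of 1 (take the identity element), so a fixed point in
  -- it is invertible.
  let A : Γ → ((E →L[ℝ] E) →L[ℝ] (E →L[ℝ] E)) := fun γ => LinearMap.toContinuousLinearMap
    (LinearMap.mulLeft ℝ (σ' γ) ∘ₗ LinearMap.mulRight ℝ (σ γ⁻¹))
  have hA : ∀ γ X, A γ X = σ' γ * (X * σ γ⁻¹) := fun γ X => rfl
  have hmul : ∀ γ' γ X, A (γ' * γ) X = A γ' (A γ X) := fun γ' γ X => by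
    simp only [hA, map_mul, mul_inv_rev, mul_assoc]
  have hAM : ∀ γ, ‖A γ‖ ≤ M * M := fun γ => by
    refine ContinuousLinearMap.opNorm_le_bound _ (by positivity) fun X => ?_
    rw [hA]
    calc ‖σ' γ * (X * σ γ⁻¹)‖ ≤ ‖σ' γ‖ * (‖X‖ * ‖σ γ⁻¹‖) :=
          (norm_mul_le _ _).trans (by gcongr; exact norm_mul_le _ _)
      _ ≤ M * (‖X‖ * M) := by gcongr <;> simp [hM, hM']
      _ = M * M * ‖X‖ := by ring
  obtain ⟨X, hXK, hX⟩ := exists_fixed_of_bounded_action A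
    (fun X => by simp [hA]) hmul hAM
    (K := ⋂ γ, {X | ‖A γ X - 1‖ ≤ ε * M}) ⟨1, by
      simp only [Set.mem_iInter, Set.mem_ofPred_eq]
      intro γ
      have h1 : A γ 1 - 1 = (σ' γ - σ γ) * σ γ⁻¹ := by
        rw [hA, one_mul, sub_mul, ← map_mul σ, mul_inv_cancel, map_one]
      rw [h1]
      exact (norm_mul_le _ _).trans (mul_le_mul (hε γ) (hM _) (norm_nonneg _) hε0)⟩
    (isClosed_iInter fun γ => isClosed_le (by fun_prop) continuous_const)
    (convex_iInter fun γ => by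
      have : {X | ‖A γ X - 1‖ ≤ ε * M} = A γ ⁻¹' Metric.closedBall 1 (ε * M) := by
        ext X
        simp [dist_eq_norm]
      rw [this]
      exact (convex_closedBall _ _).linear_preimage (A γ : (E →L[ℝ] E) →ₗ[ℝ] (E →L[ℝ] E)))
    (fun γ X hX => by
      simp only [Set.mem_iInter, Set.mem_ofPred_eq] at hX ⊢
      intro γ'
      have := hX (γ' * γ)
      rwa [hmul] at this)
  have hunit : IsUnit X := by
    have h1 : ‖1 - X‖ < 1 := by
      simp only [Set.mem_iInter, Set.mem_ofPred_eq] at hXK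
      have := hXK 1
      rw [hX] at this
      rw [norm_sub_rev]
      linarith
    simpa using isUnit_one_sub_of_norm_lt_one h1
  obtain ⟨U, rfl⟩ := hunit
  refine ⟨ContinuousLinearEquiv.unitsEquiv ℝ E U, fun γ v => ?_⟩
  have h1 : σ' γ * (U : E →L[ℝ] E) = U * σ γ := by
    have := hX γ
    rw [hA] at this
    conv_rhs => rw [← this]
    rw [mul_assoc, mul_assoc, ← map_mul σ, inv_mul_cancel, map_one, mul_one]
  exact congrArg (fun X : E →L[ℝ] E => X v) h1

end Averaging

/-! ### Spectral gap of a symmetric operator -/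

section SpectralGap

variable {E : Type*} [NormedAddCommGroup E] [InnerProductSpace ℝ E] [FiniteDimensional ℝ E]

/-- There are finitely many eigenvalues, so the largest one other than 1 leaves a gap. The constant
depends only on the set of eigenvalues, hence is shared by similar operators. -/
theorem exists_spectral_gap (a : E →ₗ[ℝ] E) (ha : ∀ l, Module.End.HasEigenvalue a l → l ≤ 1) :
    ∃ κ : ℝ, 0 < κ ∧ ∀ l, Module.End.HasEigenvalue a l → l = 1 ∨ l ≤ 1 - κ := by
  have hfin : {l : ℝ | Module.End.HasEigenvalue a l ∧ l ≠ 1}.Finite :=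
    (Module.End.finite_hasEigenvalue a).subset fun l hl => hl.1
  rcases Set.eq_empty_or_nonempty {l : ℝ | Module.End.HasEigenvalue a l ∧ l ≠ 1} with h | h
  · refine ⟨1, one_pos, fun l hl => Or.inl ?_⟩
    by_contra hne
    exact Set.eq_empty_iff_forall_notMem.1 h l ⟨hl, hne⟩
  · obtain ⟨l₀, hl₀, hmax⟩ := Set.exists_max_image _ id hfin h
    refine ⟨1 - l₀, sub_pos.2 (lt_of_le_of_ne (ha _ hl₀.1) hl₀.2), fun l hl => ?_⟩
    by_cases hne : l = 1
    · exact Or.inl hne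
    · exact Or.inr (by simpa using hmax l ⟨hl, hne⟩)

/-- In an orthonormal eigenbasis, the components of `w` with eigenvalue 1 vanish and all others have
eigenvalue at most `1 - κ`. -/
theorem spectral_gap_inequality {a : E →ₗ[ℝ] E} (ha : a.IsSymmetric) {κ : ℝ}
    (hκ : ∀ l, Module.End.HasEigenvalue a l → l = 1 ∨ l ≤ 1 - κ) {w : E}
    (hw : ∀ v, a v = v → inner ℝ v w = 0) : κ * ‖w‖ ^ 2 ≤ ‖w‖ ^ 2 - inner ℝ (a w) w := by
  set b := ha.eigenvectorBasis rfl
  set l := ha.eigenvalues rfl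
  have hb : ∀ i, a (b i) = l i • b i := fun i => ha.apply_eigenvectorBasis rfl i
  have h1 : ‖w‖ ^ 2 = ∑ i, inner ℝ (b i) w ^ 2 := by
    rw [← b.sum_sq_norm_inner_right w]
    simp
  have h2 : inner ℝ (a w) w = ∑ i, l i * inner ℝ (b i) w ^ 2 := by
    rw [← b.sum_inner_mul_inner]
    refine Finset.sum_congr rfl fun i _ => ?_
    rw [ha, hb, real_inner_smul_right, real_inner_comm]
    ring
  rw [h2, h1, Finset.mul_sum, ← Finset.sum_sub_distrib]
  refine Finset.sum_le_sum fun i _ => ?_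
  rcases hκ (l i) (ha.hasEigenvalue_eigenvalues rfl i) with h | h
  · rw [hw (b i) (by rw [hb, h, one_smul])]
    simp
  · nlinarith [sq_nonneg (inner ℝ (b i) w)]

end SpectralGap

/-! ### Normal charts and derivatives of isometries -/

section NormalCharts

variable {Y : Type*} [MetricSpace Y] {E : Type*} [NormedAddCommGroup E]

/-- Coordinates `φ` centred at `q`, with inverse `ψ`, in which the distance of `Y` is Euclidean
up to a relative error `O(r)` on the ball of radius `r`. -/
structure NormalChart (q : Y) (φ : Y → E) (ψ : E → Y) (K R : ℝ) : Prop where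
  radius_pos : 0 < R
  const_nonneg : 0 ≤ K
  const_mul_radius_le : K * R ≤ 1 / 2
  map_center : φ q = 0
  left_inv : ∀ u, ‖u‖ ≤ R → φ (ψ u) = u
  right_inv : ∀ y, dist y q ≤ R → ψ (φ y) = y
  norm_le : ∀ y, dist y q ≤ R → ‖φ y‖ ≤ 2 * dist y q
  distortion : ∀ r ≤ R, ∀ u v, ‖u‖ ≤ r → ‖v‖ ≤ r →
    |dist (ψ u) (ψ v) - ‖u - v‖| ≤ K * r * ‖u - v‖

namespace NormalChart

variable {q q' q'' : Y} {φ φ' φ'' : Y → E} {ψ ψ' ψ'' : E → Y} {K R K' R' K'' R'' : ℝ}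

theorem inv_zero (h : NormalChart q φ ψ K R) : ψ 0 = q := by
  rw [← h.map_center]
  exact h.right_inv q (by rw [dist_self]; exact h.radius_pos.le)

theorem mono (h : NormalChart q φ ψ K R) (hR' : 0 < R') (hR : R' ≤ R) (hK : K ≤ K')
    (hKR : K' * R' ≤ 1 / 2) : NormalChart q φ ψ K' R' where
  radius_pos := hR'
  const_nonneg := h.const_nonneg.trans hK
  const_mul_radius_le := hKR
  map_center := h.map_center
  left_inv u hu := h.left_inv u (hu.trans hR)
  right_inv y hy := h.right_inv y (hy.trans hR)
  norm_le y hy := h.norm_le y (hy.trans hR)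
  distortion r hr u v hu hv := by
    refine (h.distortion r (hr.trans hR) u v hu hv).trans ?_
    have := (norm_nonneg u).trans hu
    gcongr

theorem dist_le (h : NormalChart q φ ψ K R) {u v : E} (hu : ‖u‖ ≤ R) (hv : ‖v‖ ≤ R) :
    dist (ψ u) (ψ v) ≤ 2 * ‖u - v‖ := by
  have h1 := (abs_le.1 (h.distortion R le_rfl u v hu hv)).2
  have h2 := mul_le_mul_of_nonneg_right h.const_mul_radius_le (norm_nonneg (u - v))
  linarith [norm_nonneg (u - v)]

theorem le_dist (h : NormalChart q φ ψ K R) {u v : E} (hu : ‖u‖ ≤ R) (hv : ‖v‖ ≤ R) :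
    ‖u - v‖ ≤ 2 * dist (ψ u) (ψ v) := by
  have h1 := (abs_le.1 (h.distortion R le_rfl u v hu hv)).1
  have h2 := mul_le_mul_of_nonneg_right h.const_mul_radius_le (norm_nonneg (u - v))
  linarith [norm_nonneg (u - v)]

theorem dist_center_le (h : NormalChart q φ ψ K R) {u : E} (hu : ‖u‖ ≤ R) :
    dist (ψ u) q ≤ 2 * ‖u‖ := by
  have := h.dist_le hu (v := 0) (by simpa using h.radius_pos.le)
  rwa [h.inv_zero, sub_zero] at this

theorem eventually_right_inv (h : NormalChart q φ ψ K R) (h' : NormalChart q' φ' ψ' K' R')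
    {g : Y ≃ᵢ Y} (hg : g q = q') : ∀ᶠ u in 𝓝 (0 : E), ψ' (φ' (g (ψ u))) = g (ψ u) := by
  filter_upwards [Metric.closedBall_mem_nhds (0 : E) h.radius_pos,
    Metric.closedBall_mem_nhds (0 : E) (half_pos h'.radius_pos)] with u hu hu'
  rw [mem_closedBall_zero_iff] at hu hu'
  refine h'.right_inv _ ?_
  rw [← hg, g.dist_eq]
  linarith [h.dist_center_le hu]

variable [InnerProductSpace ℝ E]

/-- An isometry, read in two normal charts, is differentiable at the centre with an isometric
derivative, and there is an explicit bound of the remainder. -/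
theorem exists_linearIsometry [CompleteSpace E] (h : NormalChart q φ ψ K R)
    (h' : NormalChart q' φ' ψ' K R) {g : Y ≃ᵢ Y} (hg : g q = q') :
    ∃ A : E →ₗᵢ[ℝ] E, ∀ u, ‖u‖ ≤ R / 16 →
      ‖φ' (g (ψ u)) - A u‖ ≤ 32 * √(17 * K) * (‖u‖ * √‖u‖) := by
  have hR := h.radius_pos
  have hK := h.const_nonneg
  have hmem : ∀ u, ‖u‖ ≤ R / 16 → ‖φ' (g (ψ u))‖ ≤ 4 * ‖u‖ ∧ ψ' (φ' (g (ψ u))) = g (ψ u) := by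
    intro u hu
    have h1 : dist (g (ψ u)) q' ≤ 2 * ‖u‖ := by
      rw [← hg, g.dist_eq]
      exact h.dist_center_le (by linarith)
    exact ⟨(h'.norm_le _ (by linarith)).trans (by linarith), h'.right_inv _ (by linarith)⟩
  -- The target chart contributes 16: images have norm at most `4 * r` and differ by at most `4 * ‖u
  -- - v‖`. The source chart contributes 1, giving `17 * K`.
  obtain ⟨A, hA⟩ := exists_linearIsometry_approx (f := fun u => φ' (g (ψ u))) (κ := 17 * K)
    (R := R / 16) (by rw [h.inv_zero, hg, h'.map_center]) (by positivity) (by positivity)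
    (by linarith [h.const_mul_radius_le]) (fun r hr u v hu hv => by
      have hr0 : 0 ≤ r := (norm_nonneg u).trans hu
      obtain ⟨h1, h2⟩ := hmem u (hu.trans hr)
      obtain ⟨h3, h4⟩ := hmem v (hv.trans hr)
      have h5 := h'.distortion (4 * r) (by linarith) _ _ (h1.trans (by linarith))
        (h3.trans (by linarith))
      have h6 := h.distortion r (by linarith) u v hu hv
      have h7 := h'.le_dist (h1.trans (by linarith)) (h3.trans (by linarith))
      have h8 := h.dist_le (u := u) (v := v) (by linarith) (by linarith)
      rw [h2, h4, g.dist_eq] at h5 h7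
      have h9 : K * (4 * r) * ‖φ' (g (ψ u)) - φ' (g (ψ v))‖ ≤ K * (4 * r) * (4 * ‖u - v‖) :=
        mul_le_mul_of_nonneg_left (by linarith) (by positivity)
      rw [abs_le] at h5 h6 ⊢
      constructor <;> linarith [h5.1, h5.2, h6.1, h6.2])
  refine ⟨A, fun u hu => (hA u hu).trans (le_of_eq ?_)⟩
  rw [Real.sqrt_mul (by positivity)]
  ring

theorem exists_hasFDerivAt [CompleteSpace E] (h : NormalChart q φ ψ K R)
    (h' : NormalChart q' φ' ψ' K' R') {g : Y ≃ᵢ Y} (hg : g q = q') :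
    ∃ A : E →ₗᵢ[ℝ] E, HasFDerivAt (fun u => φ' (g (ψ u))) A.toContinuousLinearMap 0 := by
  set K₀ := max K K'
  have hK₀ : 0 ≤ K₀ := h.const_nonneg.trans (le_max_left _ _)
  set R₀ := min (min R R') (1 / (2 * (K₀ + 1)))
  have hR₀ : 0 < R₀ := lt_min (lt_min h.radius_pos h'.radius_pos) (by positivity)
  have hKR : K₀ * R₀ ≤ 1 / 2 := by
    have h1 : R₀ ≤ 1 / (2 * (K₀ + 1)) := min_le_right _ _
    calc K₀ * R₀ ≤ K₀ * (1 / (2 * (K₀ + 1))) := by gcongr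
      _ ≤ 1 / 2 := by
        rw [mul_one_div, div_le_div_iff₀ (by positivity) (by norm_num)]
        linarith
  obtain ⟨A, hA⟩ := (h.mono hR₀ ((min_le_left _ _).trans (min_le_left _ _)) (le_max_left _ _)
    hKR).exists_linearIsometry (h'.mono hR₀ ((min_le_left _ _).trans (min_le_right _ _))
      (le_max_right _ _) hKR) hg
  exact ⟨A, hasFDerivAt_of_norm_sub_le (R := R₀ / 16) (by positivity)
    (by rw [h.inv_zero, hg, h'.map_center]) hA⟩

/-- This is the chain rule: near the centre, passing through the intermediate chart and back changes
nothing. -/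
theorem hasFDerivAt_comp (h : NormalChart q φ ψ K R) (h' : NormalChart q' φ' ψ' K' R')
    {g k : Y ≃ᵢ Y} (hg : g q = q') {A B : E →L[ℝ] E}
    (hA : HasFDerivAt (fun u => φ' (g (ψ u))) A 0)
    (hB : HasFDerivAt (fun u => φ'' (k (ψ' u))) B 0) :
    HasFDerivAt (fun u => φ'' ((k * g) (ψ u))) (B * A) 0 := by
  have h0 : φ' (g (ψ 0)) = 0 := by rw [h.inv_zero, hg, h'.map_center]
  have h1 : HasFDerivAt ((fun u => φ'' (k (ψ' u))) ∘ fun u => φ' (g (ψ u))) (B.comp A) 0 :=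
    HasFDerivAt.comp 0 (by rwa [h0]) hA
  refine h1.congr_of_eventuallyEq ?_
  filter_upwards [h.eventually_right_inv h' hg] with u hu
  simp only [Function.comp_apply, hu, IsometryEquiv.mul_apply]

end NormalChart

end NormalCharts

/-! ### Tangent representations at fixed points -/

section TangentRepresentations

variable {Γ : Type*} [Group Γ] {Y : Type*} [MetricSpace Y]
  {E : Type*} [NormedAddCommGroup E] [InnerProductSpace ℝ E]

/-- Linear equivalence of representations. -/
def RepEquiv (σ τ : Γ →* (E →L[ℝ] E)) : Prop :=
  ∃ T : E ≃L[ℝ] E, ∀ γ v, τ γ (T v) = T (σ γ v)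

theorem RepEquiv.symm {σ τ : Γ →* (E →L[ℝ] E)} (h : RepEquiv σ τ) : RepEquiv τ σ := by
  obtain ⟨T, hT⟩ := h
  refine ⟨T.symm, fun γ v => ?_⟩
  rw [← T.symm_apply_apply (σ γ (T.symm v)), ← hT, T.apply_symm_apply]

theorem RepEquiv.trans {σ τ υ : Γ →* (E →L[ℝ] E)} (h : RepEquiv σ τ) (h' : RepEquiv τ υ) :
    RepEquiv σ υ := by
  obtain ⟨T, hT⟩ := h
  obtain ⟨S, hS⟩ := h'
  exact ⟨T.trans S, fun γ v => by simp [hT, hS]⟩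

/-- `σ` is the derivative at the common fixed point `q` of the action `ρ`, read in some normal
chart. -/
def IsTangentRep (ρ : Γ →* (Y ≃ᵢ Y)) (q : Y) (σ : Γ →* (E →L[ℝ] E)) : Prop :=
  ∃ (φ : Y → E) (ψ : E → Y) (K R : ℝ), NormalChart q φ ψ K R ∧
    ∀ γ, HasFDerivAt (fun u => φ (ρ γ (ψ u))) (σ γ) 0

variable {ρ : Γ →* (Y ≃ᵢ Y)} {q : Y}

theorem IsTangentRep.norm_map [CompleteSpace E] {σ : Γ →* (E →L[ℝ] E)}
    (h : IsTangentRep ρ q σ) (hq : q ∈ fixedSet ρ) (γ : Γ) (v : E) : ‖σ γ v‖ = ‖v‖ := by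
  obtain ⟨φ, ψ, K, R, hc, hσ⟩ := h
  obtain ⟨A, hA⟩ := hc.exists_hasFDerivAt hc (hq γ)
  rw [(hσ γ).unique hA]
  exact A.norm_map v

/-- The derivative `D` of the change of charts intertwines: the chain rule computes the derivative
of `ρ γ`, read from one chart to the other, in two ways. -/
theorem IsTangentRep.repEquiv [FiniteDimensional ℝ E] {σ τ : Γ →* (E →L[ℝ] E)}
    (h : IsTangentRep ρ q σ) (h' : IsTangentRep ρ q τ) (hq : q ∈ fixedSet ρ) : RepEquiv σ τ := by
  have : CompleteSpace E := FiniteDimensional.complete ℝ E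
  obtain ⟨φ, ψ, K, R, hc, hσ⟩ := h
  obtain ⟨φ', ψ', K', R', hc', hτ⟩ := h'
  have hone : (1 : Y ≃ᵢ Y) q = q := rfl
  obtain ⟨D, hD⟩ := hc.exists_hasFDerivAt hc' hone
  refine ⟨(D.toLinearIsometryEquiv rfl).toContinuousLinearEquiv, fun γ v => ?_⟩
  have h1 := hc.hasFDerivAt_comp hc' hone hD (hτ γ)
  have h2 := hc.hasFDerivAt_comp hc (hq γ) (hσ γ) hD
  rw [mul_one] at h1
  rw [one_mul] at h2
  exact congrArg (fun X : E →L[ℝ] E => X v) (h1.unique h2)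

/-- Uniqueness of derivatives makes the assignment multiplicative. The remainder bound has the same
constant and radius for all `γ`, as the comparison of nearby fixed points requires. -/
theorem NormalChart.exists_tangentRep [CompleteSpace E] {φ : Y → E} {ψ : E → Y} {K R : ℝ}
    (h : NormalChart q φ ψ K R) (hq : q ∈ fixedSet ρ) :
    ∃ σ : Γ →* (E →L[ℝ] E), (∀ γ, HasFDerivAt (fun u => φ (ρ γ (ψ u))) (σ γ) 0) ∧
      ∀ γ u, ‖u‖ ≤ R / 16 → ‖φ (ρ γ (ψ u)) - σ γ u‖ ≤ 32 * √(17 * K) * (‖u‖ * √‖u‖) := by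
  choose A hA using fun γ => h.exists_linearIsometry h (hq γ)
  have hR := h.radius_pos
  have hderiv : ∀ γ, HasFDerivAt (fun u => φ (ρ γ (ψ u))) (A γ).toContinuousLinearMap 0 :=
    fun γ => hasFDerivAt_of_norm_sub_le (R := R / 16) (by positivity)
      (by rw [h.inv_zero, hq γ, h.map_center]) (hA γ)
  refine ⟨⟨⟨fun γ => (A γ).toContinuousLinearMap, ?_⟩, fun γ γ' => ?_⟩, hderiv, hA⟩
  · refine (hderiv 1).unique ((hasFDerivAt_id (0 : E)).congr_of_eventuallyEq ?_)
    filter_upwards [Metric.closedBall_mem_nhds (0 : E) hR] with u hu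
    rw [map_one]
    exact h.left_inv u (by simpa using hu)
  · have h1 := h.hasFDerivAt_comp h (hq γ') (hderiv γ') (hderiv γ)
    rw [← map_mul] at h1
    exact (hderiv (γ * γ')).unique h1

/-- Near `q₀` there are normal charts around all points, which arise from a single chart by affine
changes of coordinates and have uniform constants. -/
def HasUniformNormalCharts (E : Type*) [NormedAddCommGroup E] [InnerProductSpace ℝ E]
    (q₀ : Y) : Prop :=
  ∃ (e : Y → E) (e' : E → Y) (L : Y → E ≃L[ℝ] E) (K R M : ℝ), ContinuousAt e q₀ ∧
    ∀ᶠ q in 𝓝 q₀, ‖(L q : E →L[ℝ] E)‖ ≤ M ∧ ‖((L q).symm : E →L[ℝ] E)‖ ≤ M ∧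
      NormalChart q (fun y => L q (e y - e q)) (fun u => e' (e q + (L q).symm u)) K R

theorem HasUniformNormalCharts.exists_tangentRep [CompleteSpace E]
    (h : HasUniformNormalCharts E q) (hq : q ∈ fixedSet ρ) :
    ∃ σ : Γ →* (E →L[ℝ] E), IsTangentRep ρ q σ := by
  obtain ⟨e, e', L, K, R, M, -, hev⟩ := h
  obtain ⟨-, -, hc⟩ := hev.self_of_nhds
  obtain ⟨σ, hσ, -⟩ := hc.exists_tangentRep hq
  exact ⟨σ, _, _, _, _, hc, hσ⟩

/-- The tangent representations at nearby common fixed points are equivalent. -/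
theorem HasUniformNormalCharts.eventually_repEquiv [FiniteDimensional ℝ E]
    (h : HasUniformNormalCharts E q) (hq : q ∈ fixedSet ρ) :
    ∀ᶠ q' in 𝓝 q, q' ∈ fixedSet ρ → ∀ σ τ : Γ →* (E →L[ℝ] E), IsTangentRep ρ q σ →
      IsTangentRep ρ q' τ → RepEquiv σ τ := by
  have : CompleteSpace E := FiniteDimensional.complete ℝ E
  obtain ⟨e, e', L, K, R, M, he, hev⟩ := h
  obtain ⟨hL₀, hL₀', hc₀⟩ := hev.self_of_nhds
  have hR := hc₀.radius_pos
  have hM0 : 0 ≤ M := (norm_nonneg _).trans hL₀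
  set C := 32 * √(17 * K) with hC
  have hC0 : 0 ≤ C := by positivity
  set C₁ := (M + 1) * (C * ((M + 1) * √(M + 1))) with hC₁
  have hC₁0 : 0 ≤ C₁ := by positivity
  have hlim : Tendsto (fun q' => ‖e q' - e q‖) (𝓝 q) (𝓝 0) := by
    have := (he.tendsto.sub_const (e q)).norm
    rwa [sub_self, norm_zero] at this
  have hlim' : Tendsto (fun q' => 6 * C₁ * √‖e q' - e q‖ * (M * M)) (𝓝 q) (𝓝 0) := by
    have h1 : Continuous fun x : ℝ => 6 * C₁ * √x * (M * M) := by fun_prop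
    have h2 := (h1.tendsto 0).comp hlim
    simpa [Function.comp_def] using h2
  filter_upwards [hev, hlim.eventually (gt_mem_nhds (show 0 < R / (32 * (M + 1)) by positivity)),
    hlim'.eventually (gt_mem_nhds one_pos)] with q' ⟨hL, hL', hc⟩ hsmall hsmall' hq' σ τ hσ hτ
  by_cases hqq : q' = q
  · subst hqq
    exact hσ.repEquiv hτ hq'
  set z₀ := e q with hz₀
  set z := e q' with hz
  set b := ‖z - z₀‖ with hb
  have hb0 : 0 < b := by
    refine norm_pos_iff.2 (sub_ne_zero.2 fun heq => hqq ?_)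
    have h1 := hc.inv_zero
    have h2 := hc₀.inv_zero
    simp only [map_zero, add_zero] at h1 h2
    rw [← h1, ← h2, heq]
  obtain ⟨σ₀, hσ₀, hσ₀'⟩ := hc₀.exists_tangentRep hq
  obtain ⟨σ₁, hσ₁, hσ₁'⟩ := hc.exists_tangentRep hq'
  have ht₀ : IsTangentRep ρ q σ₀ := ⟨_, _, _, _, hc₀, hσ₀⟩
  have ht₁ : IsTangentRep ρ q' σ₁ := ⟨_, _, _, _, hc, hσ₁⟩
  refine (hσ.repEquiv ht₀ hq).trans (RepEquiv.trans ?_ (ht₁.repEquiv hτ hq'))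
  -- the representations, read in the common chart
  let conj : (Γ →* (E →L[ℝ] E)) → (E ≃L[ℝ] E) → Γ →* (E →L[ℝ] E) := fun υ N =>
    { toFun := fun γ => (N.symm : E →L[ℝ] E) ∘L υ γ ∘L (N : E →L[ℝ] E)
      map_one' := by ext v; simp
      map_mul' := fun γ γ' => by ext v; simp }
  have hconj : ∀ υ N γ v, conj υ N γ v = N.symm (υ γ (N v)) := fun _ _ _ _ => rfl
  have hconjM : ∀ (υ : Γ →* (E →L[ℝ] E)) (N : E ≃L[ℝ] E), ‖(N : E →L[ℝ] E)‖ ≤ M →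
      ‖(N.symm : E →L[ℝ] E)‖ ≤ M → (∀ γ v, ‖υ γ v‖ = ‖v‖) → ∀ γ, ‖conj υ N γ‖ ≤ M * M := by
    intro υ N hN hN' hυ γ
    refine ContinuousLinearMap.opNorm_le_bound _ (by positivity) fun v => ?_
    rw [hconj, mul_assoc]
    refine ((N.symm : E →L[ℝ] E).le_of_opNorm_le hN' _).trans ?_
    rw [hυ]
    exact mul_le_mul_of_nonneg_left ((N : E →L[ℝ] E).le_of_opNorm_le hN _) hM0
  -- Transported to the common chart, the remainder is still of order 3/2, with a constant
  -- independent of the fixed point.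
  have approx : ∀ (υ : Γ →* (E →L[ℝ] E)) (N : E ≃L[ℝ] E) (x : E), ‖(N : E →L[ℝ] E)‖ ≤ M →
      ‖(N.symm : E →L[ℝ] E)‖ ≤ M →
      (∀ γ u, ‖u‖ ≤ R / 16 → ‖N (e (ρ γ (e' (x + N.symm u))) - x) - υ γ u‖ ≤
        C * (‖u‖ * √‖u‖)) →
      ∀ γ v a, ‖v‖ ≤ a → a ≤ R / (16 * (M + 1)) →
        ‖e (ρ γ (e' (x + v))) - x - conj υ N γ v‖ ≤ C₁ * (a * √a) := by
    intro υ N x hN hN' hυ γ v a hva ha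
    have ha0 : 0 ≤ a := (norm_nonneg v).trans hva
    have h1 : ‖N v‖ ≤ (M + 1) * a := ((N : E →L[ℝ] E).le_of_opNorm_le hN v).trans
      (mul_le_mul (by linarith) hva (norm_nonneg _) (by positivity))
    have h2 : (M + 1) * a ≤ R / 16 := by
      rw [le_div_iff₀ (by positivity)] at ha
      linarith
    have h3 := hυ γ (N v) (h1.trans h2)
    rw [N.symm_apply_apply] at h3
    have h4 : e (ρ γ (e' (x + v))) - x - conj υ N γ v =
        N.symm (N (e (ρ γ (e' (x + v))) - x) - υ γ (N v)) := by
      rw [map_sub, N.symm_apply_apply, hconj]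
    rw [h4]
    refine ((N.symm : E →L[ℝ] E).le_of_opNorm_le hN' _).trans ?_
    calc M * _ ≤ (M + 1) * (C * (‖N v‖ * √‖N v‖)) := by gcongr; linarith
      _ ≤ (M + 1) * (C * ((M + 1) * a * √((M + 1) * a))) := by gcongr
      _ = C₁ * (a * √a) := by rw [Real.sqrt_mul (by positivity), hC₁]; ring
  have approx₀ := approx σ₀ (L q) z₀ hL₀ hL₀' hσ₀'
  have approx₁ := approx σ₁ (L q') z hL hL' hσ₁'
  have hbR : 2 * b ≤ R / (16 * (M + 1)) := by
    have : R / (32 * (M + 1)) * 2 = R / (16 * (M + 1)) := by field_simp; norm_num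
    linarith
  -- Vectors `v` of length `b`, the separation of the two centres, are tested. Expanding `ρ γ` at `z
  -- + v` about both centres, and at the fixed point `z` about `z₀`, the terms in `z - z₀` cancel.
  -- The errors, 1 + 4 + 1 times `C₁ * b * √b`, become O(√b) after division by `b`.
  have hclose : ∀ γ, ‖conj σ₁ (L q') γ - conj σ₀ (L q) γ‖ ≤ 6 * C₁ * √b := by
    intro γ
    have hsphere : ∀ v, ‖v‖ = b →
        ‖conj σ₁ (L q') γ v - conj σ₀ (L q) γ v‖ ≤ 6 * C₁ * √b * b := by
      intro v hv
      have h1 := approx₁ γ v b hv.le (by linarith)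
      have h2 := approx₀ γ (v + (z - z₀)) (2 * b)
        ((norm_add_le _ _).trans (by rw [hv, ← hb]; linarith)) hbR
      have h3 := approx₀ γ (z - z₀) b hb.ge (by linarith)
      have h4 : e' z = q' := by
        have := hc.inv_zero
        simpa only [map_zero, add_zero] using this
      rw [add_sub_cancel, h4, hq' γ, ← hz] at h3
      rw [show z₀ + (v + (z - z₀)) = z + v by abel, map_add] at h2
      have h5 : √(2 * b) ≤ 2 * √b := by
        rw [Real.sqrt_mul (by norm_num)]
        gcongr
        rw [Real.sqrt_le_left (by norm_num)]
        norm_num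
      have h6 : C₁ * (2 * b * √(2 * b)) ≤ C₁ * (2 * b * (2 * √b)) := by gcongr
      generalize e (ρ γ (e' (z + v))) = X at h1 h2
      generalize conj σ₁ (L q') γ v = a₁ at h1 ⊢
      generalize conj σ₀ (L q) γ v = a₀ at h2 ⊢
      generalize conj σ₀ (L q) γ (z - z₀) = a₂ at h2 h3
      have h7 : a₁ - a₀ = (X - z₀ - (a₀ + a₂)) - (X - z - a₁) - (z - z₀ - a₂) := by abel
      rw [h7]
      refine ((norm_sub_le _ _).trans (add_le_add_left (norm_sub_le _ _) _)).trans ?_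
      linarith
    refine ContinuousLinearMap.opNorm_le_bound _ (by positivity) fun v => ?_
    rcases eq_or_ne v 0 with rfl | hv
    · simp
    have hv0 : 0 < ‖v‖ := norm_pos_iff.2 hv
    have h1 := hsphere ((b / ‖v‖) • v) (by
      rw [norm_smul, Real.norm_of_nonneg (by positivity), div_mul_cancel₀ _ hv0.ne'])
    rw [map_smul, map_smul, ← smul_sub, norm_smul, Real.norm_of_nonneg (by positivity),
      div_mul_eq_mul_div, div_le_iff₀ hv0] at h1
    rw [sub_apply]
    exact le_of_mul_le_mul_left (by linarith) hb0
  obtain ⟨T, hT⟩ := exists_intertwiner (conj σ₀ (L q)) (conj σ₁ (L q'))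
    (hconjM σ₀ _ hL₀ hL₀' (ht₀.norm_map hq)) (hconjM σ₁ _ hL hL' (ht₁.norm_map hq')) hclose hsmall'
  refine ⟨((L q).symm.trans T).trans (L q'), fun γ v => ?_⟩
  have h1 := hT γ ((L q).symm v)
  rw [hconj, hconj, (L q).apply_symm_apply] at h1
  simp only [ContinuousLinearEquiv.trans_apply]
  rw [← h1, (L q').apply_symm_apply]

/-- The equivalence class is locally constant along the fixed set. Transitivity uses that every
fixed point has some tangent representation. -/
theorem repEquiv_of_isPreconnected [FiniteDimensional ℝ E]
    (hcharts : ∀ q : Y, HasUniformNormalCharts E q) (hconn : IsPreconnected (fixedSet ρ))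
    {q' : Y} (hq : q ∈ fixedSet ρ) (hq' : q' ∈ fixedSet ρ) {σ τ : Γ →* (E →L[ℝ] E)}
    (hσ : IsTangentRep ρ q σ) (hτ : IsTangentRep ρ q' τ) : RepEquiv σ τ := by
  have : CompleteSpace E := FiniteDimensional.complete ℝ E
  refine hconn.induction₂ (fun x y => ∀ σ τ : Γ →* (E →L[ℝ] E), IsTangentRep ρ x σ →
    IsTangentRep ρ y τ → RepEquiv σ τ) (fun x hx => ?_) (fun x y z hx hy hz h h' => ?_)
    (fun x y hx hy h => ?_) hq hq' σ τ hσ hτ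
  · rw [eventually_nhdsWithin_iff]
    exact (hcharts x).eventually_repEquiv hx
  · intro σ τ hσ hτ
    obtain ⟨υ, hυ⟩ := (hcharts y).exists_tangentRep hy
    exact (h σ υ hσ hυ).trans (h' υ τ hυ hτ)
  · exact fun σ τ hσ hτ => (h τ σ hτ hσ).symm

end TangentRepresentations

/-! ### The direction from the nearest fixed point -/

section TangentVector

/-- Testing with the orthogonal projection of `w` to the line of `v` forces that projection to
vanish. -/
theorem inner_eq_zero_of_norm_le_norm_sub {E : Type*} [NormedAddCommGroup E]
    [InnerProductSpace ℝ E] {v w : E} (h : ∀ s : ℝ, ‖w‖ ≤ ‖s • v - w‖) :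
    inner ℝ v w = 0 := by
  rcases eq_or_ne v 0 with rfl | hv
  · simp
  have hv0 : 0 < ‖v‖ ^ 2 := by positivity
  have h1 := pow_le_pow_left₀ (norm_nonneg _) (h (inner ℝ v w / ‖v‖ ^ 2)) 2
  rw [norm_sub_sq_real, norm_smul, mul_pow, Real.norm_eq_abs, sq_abs, real_inner_smul_left] at h1
  have h2 : (inner ℝ v w / ‖v‖ ^ 2) ^ 2 * ‖v‖ ^ 2 = inner ℝ v w ^ 2 / ‖v‖ ^ 2 := by
    field_simp
  have h3 : inner ℝ v w / ‖v‖ ^ 2 * inner ℝ v w = inner ℝ v w ^ 2 / ‖v‖ ^ 2 := by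
    ring
  rw [h2, h3] at h1
  have h4 : inner ℝ v w ^ 2 / ‖v‖ ^ 2 ≤ 0 := by linarith
  rw [div_le_iff₀ hv0, zero_mul] at h4
  exact pow_eq_zero_iff two_ne_zero |>.1 (le_antisymm h4 (sq_nonneg _))

variable {Γ : Type*} [Group Γ] {Y : Type*} [MetricSpace Y] [CompleteSpace Y]
  {E : Type*} [NormedAddCommGroup E] [InnerProductSpace ℝ E] [FiniteDimensional ℝ E]
  {ρ : Γ →* (Y ≃ᵢ Y)}

/-- The initial direction of the geodesic from the nearest common fixed point `q` to `y`, of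
length `dist q y`, is displaced by the tangent representation at most as much as `y`, and is
orthogonal to the fixed vectors. -/
theorem IsCAT0.exists_tangent_vector (hY : IsCAT0 Y) {q y : Y} (hq : q ∈ fixedSet ρ)
    (hnear : ∀ z ∈ fixedSet ρ, dist q y ≤ dist z y) {φ : Y → E} {ψ : E → Y} {K R : ℝ}
    (hc : NormalChart q φ ψ K R) :
    ∃ (σ : Γ →* (E →L[ℝ] E)) (w : E), IsTangentRep ρ q σ ∧ ‖w‖ = dist q y ∧
      (∀ γ, ‖σ γ w - w‖ ≤ dist y (ρ γ y)) ∧ ∀ v, (∀ γ, σ γ v = v) → inner ℝ v w = 0 := by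
  have : CompleteSpace E := FiniteDimensional.complete ℝ E
  obtain ⟨σ, hσ, happrox⟩ := hc.exists_tangentRep hq
  have hR := hc.radius_pos
  have hK := hc.const_nonneg
  set C := 32 * √(17 * K)
  have hC : 0 ≤ C := by positivity
  obtain ⟨c, hgeo⟩ := hY.1 q y
  set l := dist q y with hl
  have hl0 : 0 ≤ l := dist_nonneg
  set u : ℝ → E := fun t => φ (c t) with hu
  have hsmall : ∀ B : ℝ, 0 ≤ B → ∀ᶠ t in 𝓝[>] (0 : ℝ), t * B ≤ R / 64 := by
    intro B hB
    have h1 : Tendsto (fun t : ℝ => t * B) (𝓝 0) (𝓝 (0 * B)) := tendsto_id.mul_const B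
    rw [zero_mul] at h1
    exact (h1.eventually (ge_mem_nhds (by positivity))).filter_mono nhdsWithin_le_nhds
  have hbasic : ∀ᶠ t in 𝓝[>] (0 : ℝ), 0 < t ∧ t ∈ Set.Icc (0 : ℝ) 1 ∧ t * l ≤ R / 64 := by
    filter_upwards [hsmall l hl0, self_mem_nhdsWithin,
      nhdsWithin_le_nhds (Iic_mem_nhds (zero_lt_one' ℝ))] with t h1 h2 h3
    exact ⟨h2, ⟨le_of_lt h2, h3⟩, h1⟩
  have hpoint : ∀ t, 0 < t → t ∈ Set.Icc (0 : ℝ) 1 → t * l ≤ R / 64 →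
      dist (c t) q = t * l ∧ ‖u t‖ ≤ 2 * (t * l) ∧ ψ (u t) = c t := by
    intro t _ h1 h2
    have h3 : dist (c t) q = t * l := by rw [dist_comm, hgeo.dist_left h1]
    exact ⟨h3, h3 ▸ hc.norm_le _ (by linarith), hc.right_inv _ (by linarith)⟩
  -- a limit of the rescaled coordinates
  let U : Ultrafilter ℝ := Ultrafilter.of (𝓝[>] (0 : ℝ))
  have hU : (U : Filter ℝ) ≤ 𝓝[>] 0 := Ultrafilter.of_le _
  have hU0 : (U : Filter ℝ) ≤ 𝓝 0 := hU.trans nhdsWithin_le_nhds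
  obtain ⟨w, -, hw⟩ := (isCompact_closedBall (0 : E) (2 * l)).ultrafilter_le_nhds'
    (U.map fun t => t⁻¹ • u t) (by
      refine Filter.Eventually.filter_mono hU (hbasic.mono fun t ⟨h1, h2, h3⟩ => ?_)
      simp only [mem_closedBall_zero_iff]
      rw [norm_smul, Real.norm_of_nonneg (by positivity), inv_mul_le_iff₀ h1]
      linarith [(hpoint t h1 h2 h3).2.1])
  have hw : Tendsto (fun t => t⁻¹ • u t) U (𝓝 w) := hw
  have hcont : ∀ {g : ℝ → ℝ} {a : ℝ}, Continuous g → g 0 = a → Tendsto g U (𝓝 a) :=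
    fun hg h => h ▸ (hg.tendsto 0).mono_left hU0
  refine ⟨σ, w, ⟨φ, ψ, K, R, hc, hσ⟩, ?_, fun γ => ?_, fun v hv => ?_⟩
  · refine tendsto_nhds_unique hw.norm ?_
    rw [tendsto_iff_dist_tendsto_zero]
    have h0 : Tendsto (fun t : ℝ => K * (2 * l) ^ 2 * t) U (𝓝 0) := by
      exact hcont (by fun_prop) (by simp)
    refine squeeze_zero' (Eventually.of_forall fun _ => dist_nonneg) ?_ h0
    refine Filter.Eventually.filter_mono hU (hbasic.mono fun t ⟨h1, h2, h3⟩ => ?_)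
    obtain ⟨h4, h5, h6⟩ := hpoint t h1 h2 h3
    have h7 := hc.distortion (2 * (t * l)) (by linarith) (u t) 0 h5
      (by rw [norm_zero]; positivity)
    rw [h6, hc.inv_zero, h4, sub_zero] at h7
    have h8 : K * (2 * (t * l)) * ‖u t‖ ≤ K * (2 * (t * l)) * (2 * (t * l)) := by gcongr
    have h9 : ‖t⁻¹ • u t‖ - l = t⁻¹ * (‖u t‖ - t * l) := by
      rw [norm_smul, Real.norm_of_nonneg (by positivity)]
      field_simp
    rw [Real.dist_eq, h9, abs_mul, abs_of_nonneg (by positivity), inv_mul_le_iff₀ h1, abs_sub_comm]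
    refine h7.trans (h8.trans (le_of_eq ?_))
    ring
  -- Contraction towards `q` moves `c t` by at most `t * dist y (ρ γ y)`; the chart distortion and
  -- the remainder of `ρ γ` are o(t) and vanish after rescaling.
  · have hlim : Tendsto (fun t => ‖σ γ (t⁻¹ • u t) - t⁻¹ • u t‖) U (𝓝 ‖σ γ w - w‖) :=
      ((((σ γ).continuous.tendsto w).comp hw).sub hw).norm
    have hbound : Tendsto (fun t : ℝ => dist y (ρ γ y) + 8 * K * l ^ 2 * t +
        C * (2 * l * √(2 * (t * l)))) U (𝓝 (dist y (ρ γ y))) := by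
      exact hcont (by fun_prop) (by simp)
    refine le_of_tendsto_of_tendsto hlim hbound ?_
    refine Filter.Eventually.filter_mono hU (hbasic.mono fun t ⟨h1, h2, h3⟩ => ?_)
    obtain ⟨h4, h5, h6⟩ := hpoint t h1 h2 h3
    have h7 : dist (ρ γ (c t)) q = t * l := by
      conv_lhs => rw [← hq γ]
      rw [(ρ γ).dist_eq, h4]
    have h8 : ‖φ (ρ γ (c t))‖ ≤ 2 * (t * l) := h7 ▸ hc.norm_le _ (by linarith)
    have h9 : ψ (φ (ρ γ (c t))) = ρ γ (c t) := hc.right_inv _ (by linarith)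
    have h10 := (abs_le.1 (hc.distortion (2 * (t * l)) (by linarith) _ _ h8 h5)).1
    rw [h9, h6] at h10
    have h11 : dist (ρ γ (c t)) (c t) ≤ t * dist y (ρ γ y) := by
      have h := hgeo.comp_isometry (ρ γ)
      rw [hq γ] at h
      rw [dist_comm y]
      exact hY.dist_le_mul h hgeo h2
    have h12 : ‖φ (ρ γ (c t)) - u t‖ ≤ 4 * (t * l) := (norm_sub_le _ _).trans (by linarith)
    have h13 : K * (2 * (t * l)) * ‖φ (ρ γ (c t)) - u t‖ ≤ K * (2 * (t * l)) * (4 * (t * l)) := by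
      gcongr
    have h14 := happrox γ (u t) (by linarith)
    rw [h6] at h14
    have h15 : C * (‖u t‖ * √‖u t‖) ≤ C * (2 * (t * l) * √(2 * (t * l))) := by gcongr
    have h16 : σ γ (t⁻¹ • u t) - t⁻¹ • u t = t⁻¹ • (σ γ (u t) - u t) := by
      rw [map_smul, smul_sub]
    beta_reduce
    rw [h16, norm_smul, Real.norm_of_nonneg (by positivity), inv_mul_le_iff₀ h1]
    have h17 : ‖σ γ (u t) - u t‖ ≤ ‖φ (ρ γ (c t)) - σ γ (u t)‖ + ‖φ (ρ γ (c t)) - u t‖ := by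
      rw [show σ γ (u t) - u t = (φ (ρ γ (c t)) - u t) - (φ (ρ γ (c t)) - σ γ (u t)) by abel,
        add_comm]
      exact norm_sub_le _ _
    calc ‖σ γ (u t) - u t‖ ≤ C * (2 * (t * l) * √(2 * (t * l))) +
          (t * dist y (ρ γ y) + K * (2 * (t * l)) * (4 * (t * l))) := by linarith
      _ = _ := by ring
  -- For an invariant `v`, the point `ψ (t • v)` is moved only O(t^(3/2)), so a genuine fixed point
  -- `z` lies that near. As `z` is no closer to `y` than `q` is, `t * l ≤ dist z (c t)`, which is at
  -- most `t * ‖v - w‖ + o(t)`.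
  · refine inner_eq_zero_of_norm_le_norm_sub fun s => ?_
    have hfix : ∀ γ, σ γ (s • v) = s • v := fun γ => by rw [map_smul, hv]
    generalize s • v = v at hfix
    have hlim : Tendsto (fun t => ‖v - t⁻¹ • u t‖ + K * t * (‖v‖ + 2 * l) ^ 2 +
        2 * C * (‖v‖ * √(t * ‖v‖))) U (𝓝 (‖v - w‖ + 0 + 0)) := by
      refine ((tendsto_const_nhds.sub hw).norm.add ?_).add ?_
      · exact hcont (by fun_prop) (by simp)
      · exact hcont (by fun_prop) (by simp)
    rw [add_zero, add_zero] at hlim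
    have hwl : ‖w‖ ≤ l := by
      refine le_of_tendsto_of_tendsto (hw.norm) (g := fun t : ℝ => l + K * (2 * l) ^ 2 * t) ?_ ?_
      · exact hcont (by fun_prop) (by simp)
      · refine Filter.Eventually.filter_mono hU (hbasic.mono fun t ⟨h1, h2, h3⟩ => ?_)
        obtain ⟨h4, h5, h6⟩ := hpoint t h1 h2 h3
        have h7 := (abs_le.1 (hc.distortion (2 * (t * l)) (by linarith) (u t) 0 h5
          (by rw [norm_zero]; positivity))).1
        rw [h6, hc.inv_zero, h4, sub_zero] at h7
        have h8 : K * (2 * (t * l)) * ‖u t‖ ≤ K * (2 * (t * l)) * (2 * (t * l)) := by gcongr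
        simp only [norm_smul, Real.norm_of_nonneg (inv_nonneg.2 h1.le)]
        rw [inv_mul_le_iff₀ h1]
        linarith
    refine hwl.trans (ge_of_tendsto hlim ?_)
    refine Filter.Eventually.filter_mono hU ((hbasic.and (hsmall ‖v‖ (norm_nonneg v))).mono
      fun t ⟨⟨h1, h2, h3⟩, h4⟩ => ?_)
    obtain ⟨h5, h6, h7⟩ := hpoint t h1 h2 h3
    have htv : ‖t • v‖ = t * ‖v‖ := by rw [norm_smul, Real.norm_of_nonneg h1.le]
    have hX : dist (ψ (t • v)) q ≤ 2 * (t * ‖v‖) := htv ▸ hc.dist_center_le (by linarith)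
    obtain ⟨z, hz, hzX⟩ := hY.exists_fixed_dist_le ρ (x := ψ (t • v))
      (r := 2 * (C * (t * ‖v‖ * √(t * ‖v‖)))) fun γ => by
        have h8 : dist (ρ γ (ψ (t • v))) q ≤ 2 * (t * ‖v‖) := by
          conv_lhs => rw [← hq γ]
          rwa [(ρ γ).dist_eq]
        have h9 := hc.norm_le _ (h8.trans (by linarith))
        have h10 := happrox γ (t • v) (by linarith)
        rw [map_smul, hfix, htv] at h10
        have h11 := hc.dist_le (u := φ (ρ γ (ψ (t • v)))) (v := t • v) (by linarith) (by linarith)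
        rw [hc.right_inv _ (h8.trans (by linarith))] at h11
        linarith
    have h8 := hnear z hz
    have h9 := dist_triangle z (c t) y
    rw [hgeo.dist_right h2] at h9
    have h10 := dist_triangle z (ψ (t • v)) (c t)
    have h11 : ‖t • v - u t‖ ≤ t * (‖v‖ + 2 * l) := (norm_sub_le _ _).trans (by linarith)
    have h12 := (abs_le.1 (hc.distortion (t * (‖v‖ + 2 * l)) (by linarith) (t • v) (u t)
      (by rw [htv]; gcongr; linarith) (h6.trans (by linarith [mul_nonneg h1.le (norm_nonneg v)])))).2
    rw [h7] at h12
    have h13 : K * (t * (‖v‖ + 2 * l)) * ‖t • v - u t‖ ≤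
        K * (t * (‖v‖ + 2 * l)) * (t * (‖v‖ + 2 * l)) := by gcongr
    have h14 : ‖t • v - u t‖ = t * ‖v - t⁻¹ • u t‖ := by
      rw [← Real.norm_of_nonneg h1.le, ← norm_smul, smul_sub, smul_smul,
        Real.norm_of_nonneg h1.le, mul_inv_cancel₀ h1.ne', one_smul]
    rw [h14] at h12 h13
    refine le_of_mul_le_mul_left (a := t) ?_ h1
    calc t * l ≤ t * ‖v - t⁻¹ • u t‖ + K * (t * (‖v‖ + 2 * l)) * (t * (‖v‖ + 2 * l)) +
          2 * (C * (t * ‖v‖ * √(t * ‖v‖))) := by linarith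
      _ = _ := by ring

end TangentVector

/-! ### The averaging operator of the walk -/

section AveragingOperator

variable {Γ : Type*} [Group Γ] {μ : Γ → Γ → ℝ} {E : Type*} [NormedAddCommGroup E]
  [InnerProductSpace ℝ E]

/-- The averaging (Markov) operator of the random walk in a linear representation. -/
noncomputable def IsRandomWalk.averaging (hμ : IsRandomWalk μ) (σ : Γ →* (E →L[ℝ] E)) :
    E →ₗ[ℝ] E :=
  ∑ s ∈ hμ.steps, μ 1 s • (σ s : E →ₗ[ℝ] E)

theorem IsRandomWalk.averaging_apply (hμ : IsRandomWalk μ) (σ : Γ →* (E →L[ℝ] E)) (v : E) :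
    hμ.averaging σ v = ∑ s ∈ hμ.steps, μ 1 s • σ s v := by
  simp [IsRandomWalk.averaging]

/-- Each square expands to `2 * ‖w‖ ^ 2` minus twice an inner product, and the weights sum to 1.
This identity links the spectral gap to the energy. -/
theorem IsRandomWalk.norm_sq_sub_inner_averaging (hμ : IsRandomWalk μ) {σ : Γ →* (E →L[ℝ] E)}
    (hσ : ∀ γ v, ‖σ γ v‖ = ‖v‖) (w : E) :
    ‖w‖ ^ 2 - inner ℝ (hμ.averaging σ w) w =
      1 / 2 * ∑ s ∈ hμ.steps, μ 1 s * ‖σ s w - w‖ ^ 2 := by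
  have h1 : ‖w‖ ^ 2 = ∑ s ∈ hμ.steps, μ 1 s * ‖w‖ ^ 2 := by
    rw [← Finset.sum_mul, hμ.sum_steps, one_mul]
  rw [hμ.averaging_apply, sum_inner, h1, ← Finset.sum_sub_distrib, Finset.mul_sum]
  refine Finset.sum_congr rfl fun s _ => ?_
  rw [real_inner_smul_left, norm_sub_sq_real, hσ]
  ring

/-- The adjoint of `σ s` is `σ s⁻¹`, and the weights are invariant under inversion. -/
theorem IsRandomWalk.averaging_isSymmetric (hμ : IsRandomWalk μ) {σ : Γ →* (E →L[ℝ] E)}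
    (hσ : ∀ γ v, ‖σ γ v‖ = ‖v‖) : (hμ.averaging σ).IsSymmetric := by
  intro v w
  rw [hμ.averaging_apply, hμ.averaging_apply, sum_inner, inner_sum]
  refine Finset.sum_nbij' (fun s => s⁻¹) (fun s => s⁻¹) (fun s hs => hμ.inv_mem_steps hs)
    (fun s hs => hμ.inv_mem_steps hs) (fun s _ => inv_inv s) (fun s _ => inv_inv s) fun s _ => ?_
  rw [real_inner_smul_left, real_inner_smul_right, hμ.apply_inv]
  have h1 : σ s (σ s⁻¹ w) = w := by
    rw [← mul_apply_eq_comp, ← map_mul, mul_inv_cancel, map_one, one_apply_eq_self]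
  have h2 := LinearIsometry.inner_map_map (⟨(σ s : E →ₗ[ℝ] E), hσ s⟩ : E →ₗᵢ[ℝ] E) v (σ s⁻¹ w)
  change inner ℝ (σ s v) (σ s (σ s⁻¹ w)) = _ at h2
  rw [← h2, h1]

theorem IsRandomWalk.averaging_eigenvalue_le_one (hμ : IsRandomWalk μ) {σ : Γ →* (E →L[ℝ] E)}
    (hσ : ∀ γ v, ‖σ γ v‖ = ‖v‖) {l : ℝ} (hl : Module.End.HasEigenvalue (hμ.averaging σ) l) :
    l ≤ 1 := by
  obtain ⟨w, hw⟩ := hl.exists_hasEigenvector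
  have h1 := hμ.norm_sq_sub_inner_averaging hσ w
  rw [hw.apply_eq_smul, real_inner_smul_left, real_inner_self_eq_norm_sq] at h1
  have h2 : 0 ≤ ∑ s ∈ hμ.steps, μ 1 s * ‖σ s w - w‖ ^ 2 :=
    Finset.sum_nonneg fun s _ => mul_nonneg (hμ.nonneg _ _) (sq_nonneg _)
  have h3 : 0 < ‖w‖ ^ 2 := pow_pos (norm_pos_iff.2 hw.2) 2
  refine le_of_mul_le_mul_right ?_ h3
  linarith

/-- The displacement energy of `v` vanishes, so every step fixes `v`, and the steps generate by
irreducibility. -/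
theorem IsRandomWalk.fixed_of_averaging_eq (hμ : IsRandomWalk μ) {σ : Γ →* (E →L[ℝ] E)}
    (hσ : ∀ γ v, ‖σ γ v‖ = ‖v‖) {v : E} (hv : hμ.averaging σ v = v) (γ : Γ) : σ γ v = v := by
  have h1 := hμ.norm_sq_sub_inner_averaging hσ v
  rw [hv, real_inner_self_eq_norm_sq, sub_self] at h1
  have h2 : ∀ s ∈ hμ.steps, μ 1 s * ‖σ s v - v‖ ^ 2 = 0 :=
    (Finset.sum_eq_zero_iff_of_nonneg fun s _ => mul_nonneg (hμ.nonneg _ _) (sq_nonneg _)).1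
      (by linarith)
  refine hμ.induction (P := fun γ => σ γ v = v) ?_ (fun γ s hs ih => ?_) γ
  · rw [map_one, one_apply_eq_self]
  · have h3 := (mul_eq_zero.1 (h2 s hs)).resolve_left (hμ.mem_steps.1 hs)
    rw [pow_eq_zero_iff two_ne_zero, norm_eq_zero, sub_eq_zero] at h3
    rw [map_mul, mul_apply_eq_comp, h3, ih]

/-- The equivalence need not be isometric: only eigenvalues have to be transported for a common gap.
-/
theorem IsRandomWalk.hasEigenvalue_averaging_of_repEquiv (hμ : IsRandomWalk μ)
    {σ τ : Γ →* (E →L[ℝ] E)} (h : RepEquiv σ τ) {l : ℝ}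
    (hl : Module.End.HasEigenvalue (hμ.averaging σ) l) :
    Module.End.HasEigenvalue (hμ.averaging τ) l := by
  obtain ⟨T, hT⟩ := h
  obtain ⟨w, hw⟩ := hl.exists_hasEigenvector
  refine Module.End.hasEigenvalue_of_hasEigenvector (x := T w) ⟨?_, ?_⟩
  · rw [Module.End.mem_eigenspace_iff, ← map_smul, ← hw.apply_eq_smul, hμ.averaging_apply,
      hμ.averaging_apply, map_sum]
    exact Finset.sum_congr rfl fun s _ => by rw [hT, map_smul]
  · simpa using hw.2

end AveragingOperator

/-! ### The energy bound for CAT(0) spaces with normal charts -/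

section Main

variable {Γ : Type*} [Group Γ] {μ : Γ → Γ → ℝ} {Y : Type*} [MetricSpace Y] [CompleteSpace Y]

/-- In a complete `CAT(0)` space with uniform normal charts around every point, the `n`-step
energies are uniformly bounded by the energy. -/
theorem IsCAT0.exists_energyBound (hY : IsCAT0 Y) {E : Type*} [NormedAddCommGroup E]
    [InnerProductSpace ℝ E] [FiniteDimensional ℝ E]
    (hcharts : ∀ q : Y, HasUniformNormalCharts E q) (hμ : IsRandomWalk μ) {ρ : Γ →* (Y ≃ᵢ Y)}
    (hne : (fixedSet ρ).Nonempty) : ∃ C : ℝ, 0 < C ∧ EnergyBound μ ρ C := by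
  have : CompleteSpace E := FiniteDimensional.complete ℝ E
  obtain ⟨p, hp⟩ := hne
  obtain ⟨σp, hσp⟩ := (hcharts p).exists_tangentRep hp
  obtain ⟨κ, hκ, hgap⟩ := exists_spectral_gap (hμ.averaging σp)
    fun l hl => hμ.averaging_eigenvalue_le_one (hσp.norm_map hp) hl
  refine ⟨2 / κ, by positivity, hμ.energyBound_of_displacement ρ fun y => ?_⟩
  obtain ⟨q, hq, hnear⟩ := hY.exists_nearest_fixed ρ ⟨p, hp⟩ y
  obtain ⟨e, e', L, K, R, M, -, hev⟩ := hcharts q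
  obtain ⟨-, -, hc⟩ := hev.self_of_nhds
  obtain ⟨σ, w, hσ, hw, hdisp, horth⟩ := hY.exists_tangent_vector hq hnear hc
  have hrep := repEquiv_of_isPreconnected hcharts (hY.isPreconnected_fixedSet ρ) hq hp hσ hσp
  have hiso := hσ.norm_map hq
  have h1 := spectral_gap_inequality (hμ.averaging_isSymmetric hiso)
    (fun l hl => hgap l (hμ.hasEigenvalue_averaging_of_repEquiv hrep hl)) (w := w)
    fun v hv => horth v (hμ.fixed_of_averaging_eq hiso hv)
  rw [hμ.norm_sq_sub_inner_averaging hiso] at h1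
  -- Here `D ^ 2 = 4 * ‖w‖ ^ 2`, and the gap inequality carries a factor 1/2; together they give `2
  -- / κ`.
  refine ⟨2 * dist q y, fun γ => ?_, ?_⟩
  · have h2 : dist q (ρ γ y) = dist q y := by
      conv_lhs => rw [← hq γ]
      exact (ρ γ).dist_eq _ _
    have := dist_triangle y q (ρ γ y)
    rw [h2, dist_comm y q] at this
    linarith
  · have h2 : ∑ s ∈ hμ.steps, μ 1 s * ‖σ s w - w‖ ^ 2 ≤
        ∑ s ∈ hμ.steps, μ 1 s * dist y (ρ s y) ^ 2 :=
      Finset.sum_le_sum fun s _ => mul_le_mul_of_nonneg_left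
        (pow_le_pow_left₀ (norm_nonneg _) (hdisp s) 2) (hμ.nonneg _ _)
    rw [← hw, div_mul_eq_mul_div, le_div_iff₀ hκ]
    linarith

end Main

open Bundle

/-! ### Riemannian distance read in a chart -/

section MetricTensor

variable {E : Type*} [NormedAddCommGroup E] [NormedSpace ℝ E]
  {H : Type*} [TopologicalSpace H] {I : ModelWithCorners ℝ E H}
  {M : Type*} [MetricSpace M] [ChartedSpace H M]

variable (I) in
/-- The derivative at `y` of the preferred chart at `x₀`. -/
noncomputable def chartDeriv (x₀ y : M) : TangentSpace I y →L[ℝ] E :=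
  mfderiv I 𝓘(ℝ, E) (extChartAt I x₀) y

theorem continuousLinearMapAt_eq_chartDeriv [IsManifold I ∞ M] {x₀ y : M}
    (hy : y ∈ (chartAt H x₀).source) :
    (trivializationAt E (TangentSpace I) x₀).continuousLinearMapAt ℝ y = chartDeriv I x₀ y :=
  TangentBundle.continuousLinearMapAt_trivializationAt hy

theorem symm_chartDeriv [IsManifold I ∞ M] {x₀ y : M} (hy : y ∈ (chartAt H x₀).source)
    (u : TangentSpace I y) :
    (trivializationAt E (TangentSpace I) x₀).symm y (chartDeriv I x₀ y u) = u := by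
  have hb : y ∈ (trivializationAt E (TangentSpace I : M → Type _) x₀).baseSet := by
    rwa [TangentBundle.trivializationAt_baseSet]
  rw [← continuousLinearMapAt_eq_chartDeriv hy]
  have h := (trivializationAt E (TangentSpace I) x₀).symmL_continuousLinearMapAt (R := ℝ) hb u
  rwa [Trivialization.symmL_apply _ hb] at h

/-- Every coordinate vector comes from a tangent vector, so symmetry and positivity pass from the
inner product to the metric tensor. -/
theorem chartDeriv_surjective [IsManifold I ∞ M] {x₀ y : M} (hy : y ∈ (chartAt H x₀).source) :
    Function.Surjective (chartDeriv I x₀ y) := by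
  intro v
  have hb : y ∈ (trivializationAt E (TangentSpace I) x₀).baseSet := by
    rwa [TangentBundle.trivializationAt_baseSet]
  refine ⟨(trivializationAt E (TangentSpace I) x₀).symmL ℝ y v, ?_⟩
  rw [← continuousLinearMapAt_eq_chartDeriv hy]
  exact (trivializationAt E (TangentSpace I) x₀).continuousLinearMapAt_symmL hb v

variable [RiemannianBundle (fun x : M => TangentSpace I x)]

/-- `G` is the smooth metric written in the trivialization at `x₀`, whose fibre maps are the
derivatives of the chart. -/
theorem exists_metric_tensor [I.Boundaryless] [IsManifold I ∞ M]
    [h : IsContMDiffRiemannianBundle I ∞ E (fun x : M => TangentSpace I x)] (x₀ : M) :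
    ∃ G : E → E →L[ℝ] E →L[ℝ] ℝ, ContDiffAt ℝ 1 G (extChartAt I x₀ x₀) ∧
      ∀ y ∈ (chartAt H x₀).source, ∀ v w : TangentSpace I y,
        inner ℝ v w = G (extChartAt I x₀ y) (chartDeriv I x₀ y v) (chartDeriv I x₀ y w) := by
  obtain ⟨g, g_smooth, hg⟩ := h.exists_contMDiff
  let g' : M → E →L[ℝ] E →L[ℝ] ℝ := fun y ↦
    ContinuousLinearMap.inCoordinates E (fun x : M => TangentSpace I x) (E →L[ℝ] ℝ)
      (fun x : M ↦ TangentSpace I x →L[ℝ] ℝ) x₀ y x₀ y (g y)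
  have hg' : ContMDiffAt I 𝓘(ℝ, E →L[ℝ] E →L[ℝ] ℝ) ∞ g' x₀ := by
    have W := g_smooth.contMDiffAt (x := x₀)
    rw [contMDiffAt_hom_bundle] at W
    exact W.2
  refine ⟨fun z => g' ((extChartAt I x₀).symm z), ?_, fun y hy v w => ?_⟩
  · have h1 : ContMDiffAt 𝓘(ℝ, E) 𝓘(ℝ, E →L[ℝ] E →L[ℝ] ℝ) 1 (g' ∘ (extChartAt I x₀).symm)
        (extChartAt I x₀ x₀) := by
      refine ContMDiffAt.comp (I' := I) _ ?_ ?_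
      · rw [extChartAt_to_inv]
        exact hg'.of_le (by norm_cast)
      · exact (contMDiffOn_extChartAt_symm x₀).contMDiffAt (extChartAt_target_mem_nhds x₀)
    exact contMDiffAt_iff_contDiffAt.1 h1
  · have hb : y ∈ (trivializationAt E (TangentSpace I) x₀).baseSet := by
      rwa [TangentBundle.trivializationAt_baseSet]
    have hinv : (extChartAt I x₀).symm (extChartAt I x₀ y) = y :=
      (extChartAt I x₀).left_inv (by rwa [extChartAt_source])
    rw [hg]
    beta_reduce
    rw [hinv]
    simp only [g']
    rw [inCoordinates_apply_eq₂ hb hb (Set.mem_univ _), symm_chartDeriv hy, symm_chartDeriv hy]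
    simp

open MeasureTheory in
theorem pathELength_eq_lintegral_metric_tensor [IsManifold I ∞ M] {x₀ : M}
    {G : E → E →L[ℝ] E →L[ℝ] ℝ} (hG : ∀ y ∈ (chartAt H x₀).source, ∀ v w : TangentSpace I y,
      inner ℝ v w = G (extChartAt I x₀ y) (chartDeriv I x₀ y v) (chartDeriv I x₀ y w))
    {γ : ℝ → M} (hγ : ContMDiffOn 𝓘(ℝ) I 1 γ (Set.Icc 0 1))
    (hsource : ∀ t ∈ Set.Icc (0 : ℝ) 1, γ t ∈ (chartAt H x₀).source) :
    Manifold.pathELength I γ 0 1 = ∫⁻ t in Set.Icc (0 : ℝ) 1,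
      ENNReal.ofReal √(G (extChartAt I x₀ (γ t))
        (derivWithin (extChartAt I x₀ ∘ γ) (Set.Icc 0 1) t)
        (derivWithin (extChartAt I x₀ ∘ γ) (Set.Icc 0 1) t)) := by
  rw [Manifold.pathELength_eq_lintegral_mfderivWithin_Icc]
  refine setLIntegral_congr_fun measurableSet_Icc fun t ht => ?_
  have h1 : mfderivWithin 𝓘(ℝ) 𝓘(ℝ, E) (extChartAt I x₀ ∘ γ) (Set.Icc 0 1) t =
      (mfderiv I 𝓘(ℝ, E) (extChartAt I x₀) (γ t)) ∘L
        (mfderivWithin 𝓘(ℝ) I γ (Set.Icc 0 1) t) := by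
    apply mfderiv_comp_mfderivWithin
    · exact mdifferentiableAt_extChartAt (hsource t ht)
    · exact hγ.mdifferentiableOn one_ne_zero _ ht
    · rw [uniqueMDiffWithinAt_iff_uniqueDiffWithinAt]
      exact uniqueDiffOn_Icc zero_lt_one _ ht
  have h2 : derivWithin (extChartAt I x₀ ∘ γ) (Set.Icc 0 1) t =
      chartDeriv I x₀ (γ t) (mfderivWithin 𝓘(ℝ) I γ (Set.Icc 0 1) t 1) := by
    rw [← fderivWithin_derivWithin]
    have h3 := congrArg (fun A => A 1) h1
    rw [mfderivWithin_eq_fderivWithin] at h3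
    exact h3
  rw [h2, ← hG _ (hsource t ht), real_inner_self_eq_norm_sq, Real.sqrt_sq (norm_nonneg _),
    ofReal_norm]

/-- Pushing a segment in a chart to the manifold bounds the distance from above. -/
theorem dist_symm_le_of_metric_tensor_le [I.Boundaryless] [IsManifold I ∞ M]
    [hM : IsRiemannianManifold I M] {x₀ : M}
    {G : E → E →L[ℝ] E →L[ℝ] ℝ} (hG : ∀ y ∈ (chartAt H x₀).source, ∀ v w : TangentSpace I y,
      inner ℝ v w = G (extChartAt I x₀ y) (chartDeriv I x₀ y v) (chartDeriv I x₀ y w))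
    {S : Set E} (hS : Convex ℝ S) (hST : S ⊆ (extChartAt I x₀).target) {x y : E} (hx : x ∈ S)
    (hy : y ∈ S) {b : ℝ} (hb : ∀ z ∈ S, √(G z (y - x) (y - x)) ≤ b) :
    dist ((extChartAt I x₀).symm x) ((extChartAt I x₀).symm y) ≤ b := by
  have hb0 : 0 ≤ b := (Real.sqrt_nonneg _).trans (hb x hx)
  set η : ℝ → E := fun t => x + t • (y - x) with hη
  have hηS : ∀ t ∈ Set.Icc (0 : ℝ) 1, η t ∈ S := fun t ht => hS.add_smul_sub_mem hx hy ht
  set γ : ℝ → M := (extChartAt I x₀).symm ∘ η with hγ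
  have hηsmooth : ContMDiffOn 𝓘(ℝ) 𝓘(ℝ, E) 1 η (Set.Icc 0 1) := by
    rw [contMDiffOn_iff_contDiffOn]
    exact ContDiff.contDiffOn (by fun_prop)
  have hγsmooth : ContMDiffOn 𝓘(ℝ) I 1 γ (Set.Icc 0 1) :=
    (contMDiffOn_extChartAt_symm x₀).comp hηsmooth fun t ht => hST (hηS t ht)
  have hinv : ∀ t ∈ Set.Icc (0 : ℝ) 1, (extChartAt I x₀ ∘ γ) t = η t := fun t ht =>
    (extChartAt I x₀).right_inv (hST (hηS t ht))
  have hlen := pathELength_eq_lintegral_metric_tensor hG hγsmooth fun t ht => by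
    rw [← extChartAt_source I]
    exact (extChartAt I x₀).map_target (hST (hηS t ht))
  have hle : Manifold.pathELength I γ 0 1 ≤ ENNReal.ofReal b := by
    rw [hlen]
    calc _ ≤ ∫⁻ t in Set.Icc (0 : ℝ) 1, ENNReal.ofReal b := by
          refine MeasureTheory.setLIntegral_mono' measurableSet_Icc fun t ht => ?_
          have h1 : derivWithin (extChartAt I x₀ ∘ γ) (Set.Icc 0 1) t = y - x := by
            rw [derivWithin_congr hinv (hinv t ht)]
            have h2 : HasDerivAt η (y - x) t := by
              have h3 := ((hasDerivAt_id t).smul_const (y - x)).const_add x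
              rwa [one_smul] at h3
            exact h2.hasDerivWithinAt.derivWithin (uniqueDiffOn_Icc zero_lt_one t ht)
          rw [h1]
          have h3 := hinv t ht
          simp only [Function.comp_apply] at h3
          rw [h3]
          exact ENNReal.ofReal_le_ofReal (hb _ (hηS t ht))
      _ = _ := by simp
  have h4 := (Manifold.riemannianEDist_le_pathELength hγsmooth rfl rfl zero_le_one).trans hle
  rw [← hM.out, edist_dist, ENNReal.ofReal_le_ofReal_iff hb0] at h4
  simpa [hγ, hη] using h4

open MeasureTheory in
/-- A linear map that is bounded with respect to the metric on a ball, read in a chart, is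
Lipschitz on the inner ball. -/
theorem norm_map_sub_le_of_le_metric_tensor [IsManifold I ∞ M] [hM : IsRiemannianManifold I M]
    {x₀ : M} {G : E → E →L[ℝ] E →L[ℝ] ℝ}
    (hG : ∀ y ∈ (chartAt H x₀).source, ∀ v w : TangentSpace I y,
      inner ℝ v w = G (extChartAt I x₀ y) (chartDeriv I x₀ y v) (chartDeriv I x₀ y w))
    {F : Type*} [NormedAddCommGroup F] [NormedSpace ℝ F] [CompleteSpace F]
    (A : E →L[ℝ] F) {b : ℝ} (hb0 : 0 ≤ b) {x y : M} {r : ℝ}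
    (hball : ∀ p, dist p x < r → p ∈ (chartAt H x₀).source ∧
      ∀ v, ‖A v‖ ≤ b * √(G (extChartAt I x₀ p) v v)) (hxy : dist x y < r) :
    ‖A (extChartAt I x₀ y - extChartAt I x₀ x)‖ ≤ b * dist x y := by
  have hr : 0 < r := dist_nonneg.trans_lt hxy
  -- No path need realize the distance, so paths of length less than `s` are used and `s` decreases
  -- to `dist x y`.
  suffices h : ∀ s, dist x y < s → s ≤ r →
      ‖A (extChartAt I x₀ y - extChartAt I x₀ x)‖ ≤ b * s by
    have h1 : Tendsto (fun s => b * s) (𝓝[>] (dist x y)) (𝓝 (b * dist x y)) :=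
      (tendsto_id.const_mul b).mono_left nhdsWithin_le_nhds
    refine ge_of_tendsto h1 ?_
    filter_upwards [self_mem_nhdsWithin, nhdsWithin_le_nhds (Iic_mem_nhds hxy)] with s h2 h3
    exact h s h2 h3
  intro s hs hsr
  have hlt : Manifold.riemannianEDist I x y < ENNReal.ofReal s := by
    rw [← hM.out, edist_dist, ENNReal.ofReal_lt_ofReal_iff (dist_nonneg.trans_lt hs)]
    exact hs
  obtain ⟨γ, hγ0, hγ1, hγ, hlen⟩ := Manifold.exists_lt_of_riemannianEDist_lt hlt
  -- Initial pieces of the path are also shorter than `s`, so it never leaves the ball where the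
  -- bound holds.
  have hmem : ∀ t ∈ Set.Icc (0 : ℝ) 1, dist (γ t) x < r := by
    intro t ht
    have h1 : Manifold.riemannianEDist I x (γ t) ≤ Manifold.pathELength I γ 0 t :=
      Manifold.riemannianEDist_le_pathELength (hγ.mono (Set.Icc_subset_Icc_right ht.2)) hγ0 rfl
        ht.1
    have h2 := (h1.trans (Manifold.pathELength_mono le_rfl ht.2)).trans_lt hlen
    rw [← hM.out, edist_dist, ENNReal.ofReal_lt_ofReal_iff (dist_nonneg.trans_lt hs)] at h2
    rw [dist_comm]
    exact h2.trans_le hsr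
  have hsource : ∀ t ∈ Set.Icc (0 : ℝ) 1, γ t ∈ (chartAt H x₀).source :=
    fun t ht => (hball _ (hmem t ht)).1
  set η : ℝ → E := extChartAt I x₀ ∘ γ with hη
  have hηsmooth : ContDiffOn ℝ 1 η (Set.Icc 0 1) := by
    rw [← contMDiffOn_iff_contDiffOn]
    exact (contMDiffOn_extChartAt (n := 1)).comp hγ hsource
  have h1 := enorm_sub_le_lintegral_derivWithin_Icc_of_contDiffOn_Icc
    (f := A ∘ η) (A.contDiff.comp_contDiffOn hηsmooth) zero_le_one
  have h2 : ∫⁻ t in Set.Icc (0 : ℝ) 1, ‖derivWithin (A ∘ η) (Set.Icc 0 1) t‖ₑ ≤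
      ENNReal.ofReal b * Manifold.pathELength I γ 0 1 := by
    rw [pathELength_eq_lintegral_metric_tensor hG hγ hsource,
      ← lintegral_const_mul' _ _ ENNReal.ofReal_ne_top]
    refine setLIntegral_mono' measurableSet_Icc fun t ht => ?_
    have h3 : derivWithin (A ∘ η) (Set.Icc 0 1) t = A (derivWithin η (Set.Icc 0 1) t) :=
      (A.hasFDerivAt.comp_hasDerivWithinAt t
        (hηsmooth.differentiableOn one_ne_zero t ht).hasDerivWithinAt).derivWithin
        (uniqueDiffOn_Icc zero_lt_one t ht)
    rw [h3, ← ofReal_norm, ← ENNReal.ofReal_mul hb0]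
    exact ENNReal.ofReal_le_ofReal ((hball _ (hmem t ht)).2 _)
  have h4 : ‖A (η 1) - A (η 0)‖ₑ ≤ ENNReal.ofReal (b * s) := by
    rw [ENNReal.ofReal_mul hb0]
    exact h1.trans (h2.trans (by gcongr))
  rw [← ofReal_norm, ENNReal.ofReal_le_ofReal_iff (by nlinarith [dist_nonneg (x := x) (y := y)]),
    ← map_sub] at h4
  simpa [hη, hγ0, hγ1] using h4

end MetricTensor

/-! ### Uniform normal charts on Riemannian manifolds -/

section UniformCharts

/-- These are the coordinates in an orthonormal basis for the form `B`; they make the metric tensor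
Euclidean at one point. -/
theorem exists_linearEquiv_of_posDef {V : Type*} [AddCommGroup V] [Module ℝ V]
    [FiniteDimensional ℝ V] (B : V →ₗ[ℝ] V →ₗ[ℝ] ℝ) (hsymm : ∀ v w, B v w = B w v)
    (hpos : ∀ v, v ≠ 0 → 0 < B v v) {n : ℕ} (hn : Module.finrank ℝ V = n) :
    ∃ L : V ≃ₗ[ℝ] EuclideanSpace ℝ (Fin n), ∀ v, ‖L v‖ ^ 2 = B v v := by
  let core : InnerProductSpace.Core ℝ V :=
    { inner := fun v w => B v w
      conj_inner_symm := fun v w => by simp [hsymm v w]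
      re_inner_nonneg := fun v => by
        rcases eq_or_ne v 0 with rfl | hv
        · simp
        · simpa using (hpos v hv).le
      add_left := fun v w x => by simp
      smul_left := fun v w c => by simp
      definite := fun v hv => by
        by_contra hne
        exact (hpos v hne).ne' hv }
  let i₁ : NormedAddCommGroup V := core.toNormedAddCommGroup
  let i₂ : InnerProductSpace ℝ V := InnerProductSpace.ofCore core.toCore
  let L := ((stdOrthonormalBasis ℝ V).reindex (finCongr hn)).repr
  refine ⟨L.toLinearEquiv, fun v => ?_⟩
  have h1 : ‖L v‖ = ‖v‖ := L.norm_map v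
  change ‖L v‖ ^ 2 = _
  rw [h1, ← real_inner_self_eq_norm_sq]
  rfl

set_option synthInstance.maxHeartbeats 200000 in
/-- A positive definite form depending in a locally Lipschitz way on a point is, near a given
point, uniformly comparable to the norm. -/
theorem exists_uniform_bounds {E : Type*} [NormedAddCommGroup E] [NormedSpace ℝ E]
    [FiniteDimensional ℝ E] {G : E → E →L[ℝ] E →L[ℝ] ℝ} {z₀ : E} (hG : ContDiffAt ℝ 1 G z₀)
    (hsymm : ∀ v w, G z₀ v w = G z₀ w v) (hpos : ∀ v, v ≠ 0 → 0 < G z₀ v v) {T : Set E}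
    (hT : T ∈ 𝓝 z₀) : ∃ r m Λ : ℝ, 0 < r ∧ 1 ≤ m ∧ 0 ≤ Λ ∧ Metric.ball z₀ r ⊆ T ∧
      (∀ z ∈ Metric.ball z₀ r, ∀ z' ∈ Metric.ball z₀ r, ‖G z - G z'‖ ≤ Λ * ‖z - z'‖) ∧
      ∀ z ∈ Metric.ball z₀ r, ∀ v, ‖v‖ ≤ m * √(G z v v) ∧ √(G z v v) ≤ m * ‖v‖ := by
  obtain ⟨Λ, s, hs, hΛ⟩ := hG.exists_lipschitzOnWith
  obtain ⟨L₀, hL₀⟩ := exists_linearEquiv_of_posDef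
    ((ContinuousLinearMap.coeLM ℝ).comp (G z₀ : E →ₗ[ℝ] E →L[ℝ] ℝ)) hsymm hpos rfl
  have hL₀ : ∀ v, ‖L₀ v‖ ^ 2 = G z₀ v v := hL₀
  let S : EuclideanSpace ℝ (Fin (Module.finrank ℝ E)) →L[ℝ] E :=
    L₀.toContinuousLinearEquiv.symm
  set N := ‖S‖
  have hlow : ∀ v, ‖v‖ ^ 2 ≤ N ^ 2 * G z₀ v v := by
    intro v
    rw [← hL₀, ← mul_pow]
    refine pow_le_pow_left₀ (norm_nonneg _) ?_ 2
    have h := S.le_opNorm (L₀ v)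
    have h2 : S (L₀ v) = v := L₀.symm_apply_apply v
    rwa [h2] at h
  obtain ⟨r₁, hr₁, hball⟩ := Metric.mem_nhds_iff.1 (inter_mem hs hT)
  -- The last bound keeps the perturbation of the form below half of its lower bound; the bound 1
  -- serves the upper estimate.
  set r := min r₁ (min 1 (1 / (2 * (Λ * N ^ 2 + 1)))) with hr
  have hΛ0 : (0 : ℝ) ≤ Λ := Λ.2
  have hr0 : 0 < r := lt_min hr₁ (lt_min one_pos (by positivity))
  have hsub : Metric.ball z₀ r ⊆ s ∩ T :=
    (Metric.ball_subset_ball (min_le_left _ _)).trans hball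
  have hlip : ∀ z ∈ Metric.ball z₀ r, ∀ z' ∈ Metric.ball z₀ r,
      ‖G z - G z'‖ ≤ Λ * ‖z - z'‖ := fun z hz z' hz' => by
    exact hΛ.norm_sub_le (hsub hz).1 (hsub hz').1
  -- `m` exceeds both constants for the squared norms, and `m ≤ m ^ 2` lets it serve after taking
  -- roots.
  set m := 1 + 2 * N ^ 2 + ‖G z₀‖ + Λ with hm
  have hm1 : 1 ≤ m := by
    have := norm_nonneg (G z₀)
    nlinarith [sq_nonneg N]
  have hmsq : m ≤ m ^ 2 := by nlinarith
  refine ⟨r, m, Λ, hr0, hm1, hΛ0, hsub.trans Set.inter_subset_right, hlip, fun z hz v => ?_⟩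
  have hzr : ‖z - z₀‖ < r := by simpa [dist_eq_norm] using hz
  have hdiff : |G z v v - G z₀ v v| ≤ Λ * ‖z - z₀‖ * ‖v‖ ^ 2 := by
    have h1 := (G z - G z₀).le_opNorm₂ v v
    simp only [sub_apply, Real.norm_eq_abs] at h1
    refine h1.trans ?_
    rw [mul_assoc, ← sq]
    exact mul_le_mul_of_nonneg_right (hlip z hz z₀ (Metric.mem_ball_self hr0)) (sq_nonneg _)
  have hN2 : Λ * ‖z - z₀‖ * N ^ 2 ≤ 1 / 2 := by
    have h1 : ‖z - z₀‖ ≤ 1 / (2 * (Λ * N ^ 2 + 1)) :=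
      hzr.le.trans ((min_le_right _ _).trans (min_le_right _ _))
    rw [le_div_iff₀ (by positivity)] at h1
    nlinarith [norm_nonneg (z - z₀)]
  have hz1 : ‖z - z₀‖ ≤ 1 := hzr.le.trans ((min_le_right _ _).trans (min_le_left _ _))
  have hv2 := sq_nonneg ‖v‖
  have e1 := abs_le.1 hdiff
  have hlow2 : ‖v‖ ^ 2 ≤ 2 * N ^ 2 * G z v v := by
    have h1 := hlow v
    have h2 : N ^ 2 * G z₀ v v ≤ N ^ 2 * (G z v v + Λ * ‖z - z₀‖ * ‖v‖ ^ 2) :=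
      mul_le_mul_of_nonneg_left (by linarith [e1.1]) (sq_nonneg _)
    have h3 := mul_le_mul_of_nonneg_right hN2 hv2
    nlinarith
  have hGnn : 0 ≤ G z v v := by
    by_contra h
    push Not at h
    have h1 : ‖v‖ ^ 2 ≤ 0 := by nlinarith [sq_nonneg N]
    have h2 : v = 0 := by
      rw [← norm_eq_zero]
      exact pow_eq_zero_iff two_ne_zero |>.1 (le_antisymm h1 hv2)
    rw [h2] at h
    simp at h
  have hup2 : G z v v ≤ m * ‖v‖ ^ 2 := by
    have h1 : G z₀ v v ≤ ‖G z₀‖ * ‖v‖ ^ 2 := by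
      rw [sq, ← mul_assoc]
      exact (Real.le_norm_self _).trans ((G z₀).le_opNorm₂ v v)
    have h2 : Λ * ‖z - z₀‖ * ‖v‖ ^ 2 ≤ Λ * ‖v‖ ^ 2 :=
      mul_le_mul_of_nonneg_right (mul_le_of_le_one_right hΛ0 hz1) hv2
    have h3 : 0 ≤ (1 + 2 * N ^ 2) * ‖v‖ ^ 2 := by positivity
    rw [hm]
    linarith [e1.2]
  constructor
  · refine abs_le_of_sq_le_sq' ?_ (by positivity) |>.2
    rw [mul_pow, Real.sq_sqrt hGnn]
    refine hlow2.trans (mul_le_mul_of_nonneg_right (le_trans ?_ hmsq) hGnn)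
    linarith [norm_nonneg (G z₀)]
  · refine Real.sqrt_le_left (by positivity) |>.2 ?_
    rw [mul_pow]
    exact hup2.trans (mul_le_mul_of_nonneg_right hmsq hv2)

/-- The change is at most `η * ‖v‖ ^ 2 ≤ η * m ^ 2 * B v v`, and √(1 + x) ≤ 1 + x for x ≥ 0. -/
theorem sqrt_form_le_of_lipschitz {E : Type*} [NormedAddCommGroup E] [NormedSpace ℝ E]
    {B B' : E →L[ℝ] E →L[ℝ] ℝ} {v : E} {m η : ℝ} (hη : 0 ≤ η)
    (hB : ‖v‖ ≤ m * √(B v v)) (hBB' : ‖B' - B‖ ≤ η) :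
    √(B' v v) ≤ (1 + η * m ^ 2) * √(B v v) := by
  rcases le_or_gt (B v v) 0 with h0 | h0
  · rw [Real.sqrt_eq_zero_of_nonpos h0, mul_zero] at hB
    have hv : v = 0 := norm_le_zero_iff.1 hB
    simp [hv]
  have h1 := (B' - B).le_opNorm₂ v v
  simp only [sub_apply, Real.norm_eq_abs] at h1
  have h2 : ‖v‖ ^ 2 ≤ m ^ 2 * B v v := by
    have := pow_le_pow_left₀ (norm_nonneg _) hB 2
    rwa [mul_pow, Real.sq_sqrt h0.le] at this
  have h3 : ‖B' - B‖ * ‖v‖ * ‖v‖ ≤ η * (m ^ 2 * B v v) := by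
    rw [mul_assoc, ← sq]
    exact mul_le_mul hBB' h2 (sq_nonneg _) hη
  have h4 : 0 ≤ η * m ^ 2 := by positivity
  refine Real.sqrt_le_left (by positivity) |>.2 ?_
  rw [mul_pow, Real.sq_sqrt h0.le]
  have h5 := (abs_le.1 h1).2
  have h6 : (1 + η * m ^ 2) * B v v ≤ (1 + η * m ^ 2) ^ 2 * B v v :=
    mul_le_mul_of_nonneg_right (by nlinarith) h0.le
  linarith

/-- Uniform normal charts exist as soon as the distance is governed, in some chart, by a metric
tensor that is Lipschitz and comparable to the norm. -/
theorem hasUniformNormalCharts_of_metric_tensor {Y : Type*} [MetricSpace Y] {d : ℕ}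
    {e : Y → EuclideanSpace ℝ (Fin d)} {e' : EuclideanSpace ℝ (Fin d) → Y} {q₀ : Y}
    {G : EuclideanSpace ℝ (Fin d) →
      EuclideanSpace ℝ (Fin d) →L[ℝ] EuclideanSpace ℝ (Fin d) →L[ℝ] ℝ}
    {r₀ m Λ δ : ℝ} (hr₀ : 0 < r₀) (hm : 1 ≤ m) (hΛ : 0 ≤ Λ) (hδ : 0 < δ)
    (hlip : ∀ z ∈ Metric.ball (e q₀) r₀, ∀ z' ∈ Metric.ball (e q₀) r₀,
      ‖G z - G z'‖ ≤ Λ * ‖z - z'‖)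
    (hbound : ∀ z ∈ Metric.ball (e q₀) r₀, ∀ v,
      ‖v‖ ≤ m * √(G z v v) ∧ √(G z v v) ≤ m * ‖v‖)
    (hsymm : ∀ z ∈ Metric.ball (e q₀) r₀, ∀ v w, G z v w = G z w v)
    (hright : ∀ z ∈ Metric.ball (e q₀) r₀, e (e' z) = z)
    (hleft : ∀ p, dist p q₀ < δ → e p ∈ Metric.ball (e q₀) r₀ ∧ e' (e p) = p)
    (hup : ∀ S : Set (EuclideanSpace ℝ (Fin d)), Convex ℝ S → S ⊆ Metric.ball (e q₀) r₀ →
      ∀ x ∈ S, ∀ y ∈ S, ∀ b : ℝ, (∀ z ∈ S, √(G z (y - x) (y - x)) ≤ b) →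
        dist (e' x) (e' y) ≤ b)
    (hlow : ∀ (A : EuclideanSpace ℝ (Fin d) →L[ℝ] EuclideanSpace ℝ (Fin d)) (b : ℝ), 0 ≤ b →
      ∀ x y r, (∀ p, dist p x < r → dist p q₀ < δ ∧ ∀ v, ‖A v‖ ≤ b * √(G (e p) v v)) →
        dist x y < r → ‖A (e y - e x)‖ ≤ b * dist x y) :
    HasUniformNormalCharts (EuclideanSpace ℝ (Fin d)) q₀ := by
  have hm0 : 0 < m := by linarith
  have crude_up : ∀ x ∈ Metric.ball (e q₀) r₀, ∀ y ∈ Metric.ball (e q₀) r₀,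
      dist (e' x) (e' y) ≤ m * ‖x - y‖ := fun x hx y hy => by
    rw [norm_sub_rev]
    exact hup _ (convex_ball _ _) subset_rfl x hx y hy _ fun z hz => (hbound z hz _).2
  have crude_low : ∀ p p', dist p q₀ < δ / 3 → dist p' q₀ < δ / 3 →
      ‖e p' - e p‖ ≤ m * dist p p' := fun p p' hp hp' => by
    refine hlow (ContinuousLinearMap.id ℝ _) m hm0.le p p' (2 * δ / 3) (fun x hx => ?_) ?_
    · have h1 : dist x q₀ < δ := (dist_triangle x p q₀).trans_lt (by linarith)
      exact ⟨h1, fun v => (hbound _ (hleft x h1).1 v).1⟩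
    · have := dist_triangle_right p p' q₀
      linarith
  have hL : ∀ q, ∃ L : EuclideanSpace ℝ (Fin d) ≃L[ℝ] EuclideanSpace ℝ (Fin d),
      e q ∈ Metric.ball (e q₀) r₀ → ∀ v, ‖L v‖ = √(G (e q) v v) := by
    intro q
    by_cases hq : e q ∈ Metric.ball (e q₀) r₀
    · obtain ⟨L, hL⟩ := exists_linearEquiv_of_posDef ((ContinuousLinearMap.coeLM ℝ).comp
        (G (e q) : EuclideanSpace ℝ (Fin d) →ₗ[ℝ] EuclideanSpace ℝ (Fin d) →L[ℝ] ℝ))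
        (hsymm _ hq) (fun v hv => by
          have h1 := (norm_pos_iff.2 hv).trans_le (hbound _ hq v).1
          exact Real.sqrt_pos.1 (pos_of_mul_pos_right h1 hm0.le)) (n := d) (by simp)
      have hL : ∀ v, ‖L v‖ ^ 2 = G (e q) v v := hL
      refine ⟨L.toContinuousLinearEquiv, fun _ v => ?_⟩
      rw [← hL, Real.sqrt_sq (norm_nonneg _)]
      rfl
    · exact ⟨ContinuousLinearEquiv.refl ℝ _, fun h => absurd h hq⟩
  choose L hL using hL
  -- The three bounds keep coordinates in the ball of radius `r₀`, keep points within `δ` of `q₀`,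
  -- and give `K * R ≤ 1 / 2` for `K = 8 * Λ * m ^ 5`.
  set R := min (r₀ / (4 * m)) (min (δ / (48 * m ^ 2)) (1 / (16 * (Λ + 1) * m ^ 5))) with hR
  have hR0 : 0 < R := lt_min (by positivity) (lt_min (by positivity) (by positivity))
  have hR1 : m * R ≤ r₀ / 4 := by
    have h : R ≤ r₀ / (4 * m) := min_le_left _ _
    rw [le_div_iff₀ (by positivity)] at h
    linarith
  have hR2 : m ^ 2 * R ≤ δ / 48 := by
    have h : R ≤ δ / (48 * m ^ 2) := (min_le_right _ _).trans (min_le_left _ _)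
    rw [le_div_iff₀ (by positivity)] at h
    linarith
  have hR3 : Λ * m ^ 5 * R ≤ 1 / 16 := by
    have h : R ≤ 1 / (16 * (Λ + 1) * m ^ 5) := (min_le_right _ _).trans (min_le_right _ _)
    rw [le_div_iff₀ (by positivity)] at h
    have : 0 ≤ R * m ^ 5 := by positivity
    linarith
  have hmR : R ≤ m ^ 2 * R := le_mul_of_one_le_left hR0.le (one_le_pow₀ hm)
  have hm35 : m ^ 3 ≤ m ^ 5 := pow_le_pow_right₀ hm (by norm_num)
  have hR4 : Λ * m ^ 3 * R ≤ 1 / 16 := (by gcongr : Λ * m ^ 3 * R ≤ Λ * m ^ 5 * R).trans hR3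
  have hcont : ContinuousAt e q₀ := by
    rw [Metric.continuousAt_iff]
    intro ε hε
    refine ⟨min (δ / 3) (ε / m), lt_min (by positivity) (by positivity), fun {p} hp => ?_⟩
    have h1 := crude_low p q₀ (hp.trans_le (min_le_left _ _)) (by rw [dist_self]; positivity)
    have h2 := hp.trans_le (min_le_right _ _)
    rw [lt_div_iff₀ hm0] at h2
    rw [dist_comm, dist_eq_norm]
    linarith
  refine ⟨e, e', L, 8 * Λ * m ^ 5, R, m, hcont, ?_⟩
  filter_upwards [Metric.ball_mem_nhds q₀ (show 0 < δ / 12 by positivity),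
    hcont.preimage_mem_nhds (Metric.ball_mem_nhds (e q₀) (show 0 < r₀ / 2 by positivity))]
    with q hq hq'
  rw [Metric.mem_ball] at hq
  rw [Set.mem_preimage, Metric.mem_ball, dist_eq_norm] at hq'
  have hqball : e q ∈ Metric.ball (e q₀) r₀ := (hleft q (by linarith)).1
  have hqinv : e' (e q) = q := (hleft q (by linarith)).2
  have hLq := hL q hqball
  have hLm : ∀ v, ‖L q v‖ ≤ m * ‖v‖ := fun v => (hLq v).trans_le (hbound _ hqball v).2
  have hLm' : ∀ u, ‖(L q).symm u‖ ≤ m * ‖u‖ := fun u => by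
    have := (hbound _ hqball ((L q).symm u)).1
    rwa [← hLq, (L q).apply_symm_apply] at this
  have hball : ∀ x, ‖x - e q‖ ≤ r₀ / 4 → x ∈ Metric.ball (e q₀) r₀ := fun x hx => by
    rw [Metric.mem_ball, dist_eq_norm, ← sub_add_sub_cancel x (e q) (e q₀)]
    exact (norm_add_le _ _).trans_lt (by linarith)
  -- At distance `s` from `q` the metric tensor has changed by at most `Λ * m * s`, so it dominates
  -- the form at `q` up to that relative order.
  have near : ∀ p s, dist p q ≤ δ / 12 → dist p q ≤ s → dist p q₀ < δ ∧
      ∀ v, ‖L q v‖ ≤ (1 + Λ * (m * s) * m ^ 2) * √(G (e p) v v) := by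
    intro p s hp hps
    have h1 : dist p q₀ < δ / 3 := (dist_triangle p q q₀).trans_lt (by linarith)
    have h2 := (hleft p (by linarith)).1
    refine ⟨by linarith, fun v => ?_⟩
    rw [hLq]
    refine sqrt_form_le_of_lipschitz (mul_nonneg hΛ (mul_nonneg hm0.le (dist_nonneg.trans hps)))
      (hbound _ h2 v).1 ((hlip _ hqball _ h2).trans ?_)
    have h3 := crude_low p q h1 (by linarith)
    gcongr
    exact h3.trans (by gcongr)
  refine ⟨ContinuousLinearMap.opNorm_le_bound _ hm0.le hLm,
    ContinuousLinearMap.opNorm_le_bound _ hm0.le hLm', hR0, by positivity, by linarith, by simp,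
    fun u hu => ?_, fun y hy => ?_, fun y hy => ?_, fun r hr u v hu hv => ?_⟩
  · rw [hright _ (hball _ ?_), add_sub_cancel_left, (L q).apply_symm_apply]
    rw [add_sub_cancel_left]
    exact (hLm' u).trans ((by gcongr : m * ‖u‖ ≤ m * R).trans hR1)
  · rw [(L q).symm_apply_apply, add_sub_cancel]
    exact (hleft y ((dist_triangle y q q₀).trans_lt (by linarith))).2
  · have h1 := hlow (L q : _ →L[ℝ] _) (1 + Λ * (m * (2 * R)) * m ^ 2) (by positivity) q y (2 * R)
      (fun p hp => near p (2 * R) (by linarith) hp.le) (by rw [dist_comm]; linarith)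
    rw [dist_comm]
    refine h1.trans (mul_le_mul_of_nonneg_right ?_ dist_nonneg)
    linarith
  · have hr0 : 0 ≤ r := (norm_nonneg u).trans hu
    rcases hr0.eq_or_lt with rfl | hr0
    · have hu0 : u = 0 := norm_le_zero_iff.1 hu
      have hv0 : v = 0 := norm_le_zero_iff.1 hv
      simp [hu0, hv0]
    have hmr : m * r ≤ m * R := by gcongr
    have hmr2 : m ^ 2 * r ≤ m ^ 2 * R := by gcongr
    have hΛr3 : Λ * m ^ 3 * r ≤ Λ * m ^ 3 * R := by gcongr
    set x := e q + (L q).symm u with hx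
    set y := e q + (L q).symm v with hy
    have hxr : ‖x - e q‖ ≤ m * r := by
      rw [hx, add_sub_cancel_left]
      exact (hLm' u).trans (by gcongr)
    have hyr : ‖y - e q‖ ≤ m * r := by
      rw [hy, add_sub_cancel_left]
      exact (hLm' v).trans (by gcongr)
    have hxb := hball x (by linarith)
    have hyb := hball y (by linarith)
    have hLxy : ‖L q (y - x)‖ = ‖u - v‖ := by
      rw [hx, hy, add_sub_add_left_eq_sub, map_sub, (L q).apply_symm_apply,
        (L q).apply_symm_apply, norm_sub_rev]
    have h1 : dist (e' x) (e' y) ≤ (1 + Λ * (m * r) * m ^ 2) * ‖u - v‖ := by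
      refine hup (Metric.closedBall (e q) (m * r)) (convex_closedBall _ _) (fun z hz => ?_) x
        (by rwa [Metric.mem_closedBall, dist_eq_norm]) y
        (by rwa [Metric.mem_closedBall, dist_eq_norm]) _ fun z hz => ?_
      · rw [Metric.mem_closedBall, dist_eq_norm] at hz
        exact hball z (by linarith)
      · rw [Metric.mem_closedBall, dist_eq_norm] at hz
        rw [← hLxy, hLq]
        refine sqrt_form_le_of_lipschitz (by positivity) (hbound _ hqball _).1
          ((hlip z (hball z (by linarith)) _ hqball).trans ?_)
        gcongr
    have hdq : dist (e' x) q ≤ m ^ 2 * r := by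
      have h2 := crude_up x hxb (e q) hqball
      rw [hqinv] at h2
      refine h2.trans ?_
      rw [sq, mul_assoc]
      gcongr
    have hdxy : dist (e' x) (e' y) ≤ 2 * (m ^ 2 * r) := by
      have h2 := crude_up x hxb y hyb
      have h3 : ‖x - y‖ ≤ 2 * (m * r) := by
        rw [← sub_sub_sub_cancel_right x y (e q)]
        exact (norm_sub_le _ _).trans (by linarith)
      calc dist (e' x) (e' y) ≤ m * ‖x - y‖ := h2
        _ ≤ m * (2 * (m * r)) := by gcongr
        _ = _ := by ring
    have hm2r : 0 < m ^ 2 * r := by positivity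
    -- The ball of radius `3 * (m ^ 2 * r)` about `e' x` lies within `4 * (m ^ 2 * r)` of `q`. With
    -- `dist (e' x) (e' y) ≤ 2 * ‖u - v‖` this produces the factor 8 in `K`.
    have h2 := hlow (L q : _ →L[ℝ] _) (1 + Λ * (m * (4 * (m ^ 2 * r))) * m ^ 2) (by positivity)
      (e' x) (e' y) (3 * (m ^ 2 * r)) (fun p hp => by
        have h3 : dist p q ≤ 4 * (m ^ 2 * r) := (dist_triangle p (e' x) q).trans (by linarith)
        exact near p _ (by linarith) h3) (by linarith)
    rw [hright x hxb, hright y hyb] at h2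
    have h2 : ‖u - v‖ ≤ (1 + Λ * (m * (4 * (m ^ 2 * r))) * m ^ 2) * dist (e' x) (e' y) :=
      hLxy ▸ h2
    have hn := norm_nonneg (u - v)
    have h3 : dist (e' x) (e' y) ≤ 2 * ‖u - v‖ := by
      refine h1.trans (mul_le_mul_of_nonneg_right ?_ hn)
      linarith
    have h4 : Λ * (m * (4 * (m ^ 2 * r))) * m ^ 2 * dist (e' x) (e' y) ≤
        Λ * (m * (4 * (m ^ 2 * r))) * m ^ 2 * (2 * ‖u - v‖) := by gcongr
    have h5 : Λ * (m * r) * m ^ 2 * ‖u - v‖ ≤ 8 * Λ * m ^ 5 * r * ‖u - v‖ := by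
      refine mul_le_mul_of_nonneg_right ?_ hn
      have h6 : Λ * m ^ 3 * r ≤ Λ * m ^ 5 * r := by gcongr
      have h7 : 0 ≤ Λ * m ^ 5 * r := by positivity
      linarith
    change |dist (e' x) (e' y) - ‖u - v‖| ≤ _
    rw [abs_le]
    constructor <;> linarith

/-- A space whose metric is Riemannian has uniform normal charts around every point. -/
theorem IsRiemannianManifoldMetric.hasUniformNormalCharts {Y : Type*} [MetricSpace Y]
    (hY : IsRiemannianManifoldMetric Y) :
    ∃ d : ℕ, ∀ q : Y, HasUniformNormalCharts (EuclideanSpace ℝ (Fin d)) q := by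
  obtain ⟨d, _, _, _, _, _⟩ := hY
  refine ⟨d, fun q₀ => ?_⟩
  obtain ⟨G, hGsmooth, hG⟩ := exists_metric_tensor (I := 𝓡 d) q₀
  set c := extChartAt (𝓡 d) q₀ with hc
  have hsource : ∀ z ∈ c.target, c.symm z ∈ (chartAt (EuclideanSpace ℝ (Fin d)) q₀).source := by
    intro z hz
    rw [← extChartAt_source (𝓡 d)]
    exact c.map_target hz
  have hsymm : ∀ z ∈ c.target, ∀ v w, G z v w = G z w v := by
    intro z hz v w
    obtain ⟨v', rfl⟩ := chartDeriv_surjective (I := 𝓡 d) (hsource z hz) v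
    obtain ⟨w', rfl⟩ := chartDeriv_surjective (I := 𝓡 d) (hsource z hz) w
    have h1 := hG _ (hsource z hz) v' w'
    have h2 := hG _ (hsource z hz) w' v'
    rw [c.right_inv hz] at h1 h2
    rw [← h1, ← h2, real_inner_comm]
  have hpos : ∀ z ∈ c.target, ∀ v, v ≠ 0 → 0 < G z v v := by
    intro z hz v hv
    obtain ⟨v', rfl⟩ := chartDeriv_surjective (I := 𝓡 d) (hsource z hz) v
    have h1 := hG _ (hsource z hz) v' v'
    rw [c.right_inv hz] at h1
    rw [← h1]
    refine real_inner_self_pos.2 fun h => hv ?_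
    rw [h, map_zero]
  have htarget : c.target ∈ 𝓝 (c q₀) := extChartAt_target_mem_nhds q₀
  have hz₀ : c q₀ ∈ c.target := mem_of_mem_nhds htarget
  obtain ⟨r, m, Λ, hr, hm, hΛ, hball, hlip, hbound⟩ :=
    exists_uniform_bounds hGsmooth (hsymm _ hz₀) (hpos _ hz₀) htarget
  have hnhds : c.source ∩ c ⁻¹' Metric.ball (c q₀) r ∈ 𝓝 q₀ :=
    inter_mem (extChartAt_source_mem_nhds q₀)
      ((continuousAt_extChartAt q₀).preimage_mem_nhds (Metric.ball_mem_nhds _ hr))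
  obtain ⟨δ, hδ, hδball⟩ := Metric.mem_nhds_iff.1 hnhds
  have hδ' : ∀ p, dist p q₀ < δ → p ∈ c.source ∧ c p ∈ Metric.ball (c q₀) r :=
    fun p hp => hδball hp
  refine hasUniformNormalCharts_of_metric_tensor (e := c) (e' := c.symm) hr hm hΛ hδ hlip hbound
    (fun z hz => hsymm z (hball hz)) (fun z hz => c.right_inv (hball hz))
    (fun p hp => ⟨(hδ' p hp).2, c.left_inv (hδ' p hp).1⟩)
    (fun S hS hSball x hx y hy b hb =>
      dist_symm_le_of_metric_tensor_le hG hS (hSball.trans hball) hx hy hb)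
    (fun A b hb x y s hs hxy => norm_map_sub_le_of_le_metric_tensor hG A hb (fun p hp => ?_) hxy)
  obtain ⟨h1, h2⟩ := hs p hp
  refine ⟨?_, h2⟩
  rw [← extChartAt_source (𝓡 d)]
  exact (hδ' p h1).1

end UniformCharts

end NStepEnergy

theorem mainTheorem11 {Γ : Type*} [Group Γ] [Group.FG Γ]
    (μ : Γ → Γ → ℝ) (hμ : NStepEnergy.IsRandomWalk μ)
    {Y : Type*} [MetricSpace Y] [CompleteSpace Y]
    (hY : (NStepEnergy.IsCAT0 Y ∧ NStepEnergy.IsRiemannianManifoldMetric Y) ∨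
      NStepEnergy.IsRTree Y)
    (ρ : Γ →* (Y ≃ᵢ Y)) (hfix : ∃ p : Y, ∀ γ : Γ, ρ γ p = p) :
    (∃ C : ℝ, 0 < C ∧ NStepEnergy.EnergyBound μ ρ C ∧
      ∀ n : ℕ, C < n → NStepEnergy.GromovCriterion μ ρ n) ∧
    (∃ n : ℕ, NStepEnergy.GromovCriterion μ ρ n) ∧
    (NStepEnergy.IsRTree Y →
      ∃ m : ℝ, IsLeast (μ 1 '' {s : Γ | μ 1 s ≠ 0}) m ∧ 0 < m ∧
        NStepEnergy.EnergyBound μ ρ m⁻¹ ∧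
        ∀ n : ℕ, m⁻¹ < n → NStepEnergy.GromovCriterion μ ρ n) := by
  obtain ⟨m, hm, hpos⟩ := hμ.exists_isLeast
  have htree : NStepEnergy.IsRTree Y → NStepEnergy.EnergyBound μ ρ m⁻¹ :=
    fun h => h.energyBound hμ hfix hm hpos
  obtain ⟨C, hC, hbound⟩ : ∃ C : ℝ, 0 < C ∧ NStepEnergy.EnergyBound μ ρ C := by
    rcases hY with ⟨hcat, hriem⟩ | h
    · obtain ⟨d, hcharts⟩ := hriem.hasUniformNormalCharts
      exact hcat.exists_energyBound hcharts hμ hfix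
    · exact ⟨m⁻¹, inv_pos.2 hpos, htree h⟩
  obtain ⟨n, hn⟩ := exists_nat_gt C
  exact ⟨⟨C, hC, hbound, fun n hn => hbound.gromovCriterion hC hn⟩,
    ⟨n, hbound.gromovCriterion hC hn⟩,
    fun h => ⟨m, hm, hpos, htree h, fun n hn => (htree h).gromovCriterion (inv_pos.2 hpos) hn⟩⟩
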